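/- Let $V$ be a smooth real manifold (finite-dimensional, Hausdorff, second countable) and let ${\cal A}\to V$ be a Lie algebroid: a smooth vector bundle of finite rank with a Lie bracket $\lfloor\,,\rfloor$ on $\Gamma({\cal A})$ and a bundle map (anchor) $\delta:{\cal A}\to TV$ such that $[\delta_{\varepsilon_1},\delta_{\varepsilon_2}]=\delta_{\lfloor\varepsilon_1,\varepsilon_2\rfloor}$ and $\lfloor\varepsilon_1,f\varepsilon_2\rfloor=f\lfloor\varepsilon_1,\varepsilon_2\rfloor+(\delta_{\varepsilon_1}f)\varepsilon_2$ for $f\in C^\infty(V)$. *Affinizations.* Let ${\cal L}\to V$ be a real line bundle that has local frames $e_\alpha$ over some open covering with transition functions $e_\alpha=\exp(c_{\alpha\beta})\,e_\beta$. Let $\pi:{\cal R}={\rm Conn}({\cal L})\to V$ be the bundle whose fibre over $x$ is the set of connections on ${\cal L}$ at $x$. In a local frame $e$ a connection is given by its connection form $p_e\in T^*_xV$, and $p_{ge}=p_e+dg/g$; so $p_\alpha=p_\beta+dc_{\alpha\beta}$. The coordinates $(x,p_e)$ are Darboux coordinates of the symplectic form $dp\wedge dx$ on ${\cal R}$; the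 Poisson bracket is $\{F,G\}=\sum_a\left(\partial_{p_a}F\,\partial_{x_a}G-\partial_{x_a}F\,\partial_{p_a}G\right)$. *Lifts.* A lift of the anchor action to ${\cal R}$ is a fibrewise linear map $h:\pi^*{\cal A}\to\mathbb R$ such that, for all $\varepsilon,\varepsilon_1,\varepsilon_2\in\Gamma({\cal A})$ and $f\in C^\infty(V)$, the function $h_\varepsilon$ on ${\cal R}$ is smooth, $\{h_\varepsilon,\pi^*f\}=\pi^*(\delta_\varepsilon f)$ (the canonical transformation generated by $h_\varepsilon$ covers the anchor action), and $\{h_{\varepsilon_1},h_{\varepsilon_2}\}=h_{\lfloor\varepsilon_1,\varepsilon_2\rfloor}$. Two lifts, $({\cal L},h)$ and $({\cal L}',h')$, are equivalent if there is an isomorphism ${\cal L}\to{\cal L}'$ over the identity of $V$ such that the induced map ${\rm Conn}({\cal L})\to{\rm Conn}({\cal L}')$ takes $h$ to $h'$. *Cohomology.* Let $U=(U_\alpha)$ be any open covering of $V$ (the coefficient sheaves are sheaves of $C^\infty$-modules, hence acyclic on every open set). $H^1({\cal A},V)$ is the first cohomology of the Čech bicomplex of $U$ with coefficients in $\wedge^\bullet{\cal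 A}^*$: the space of pairs $(c_\alpha,c_{\alpha\beta})$, $c_\alpha\in\Gamma(U_\alpha,{\cal A}^*)$, $c_{\alpha\beta}\in C^\infty(U_\alpha\cap U_\beta)$, with $$c_\alpha(\lfloor\varepsilon_1,\varepsilon_2\rfloor)=\delta_{\varepsilon_1}c_\alpha(\varepsilon_2)-\delta_{\varepsilon_2}c_\alpha(\varepsilon_1),\qquad \delta_\varepsilon c_{\alpha\beta}=-c_\alpha(\varepsilon)+c_\beta(\varepsilon),\qquad c_{\alpha\gamma}=c_{\alpha\beta}+c_{\beta\gamma},$$ modulo the pairs $(\delta f_\alpha,\ f_\beta-f_\alpha)$ with $f_\alpha\in C^\infty(U_\alpha)$. **Lemma 2.1.** 1. Each ${\cal R}={\rm Conn}({\cal L})$ is an affinization of $T^*V$ (every $T^*_xV$ acts simply transitively on the fibre ${\cal R}_x$), and the anchor action of ${\cal A}$ has a lift to ${\cal R}$. 2. Every lift $h$ makes the bundle ${\cal A}^H=\pi^*{\cal A}$ over ${\cal R}$ a Hamiltonian algebroid with the same structure functions as ${\cal A}$: the bundle map $h$ takes smooth sections to smooth functions, and there is a bracket $\lfloor\varepsilon,\sigma\rfloor\in\Gamma({\cal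 A}^H)$ of the sections $\varepsilon\in\Gamma({\cal A})$, which generate $\Gamma({\cal A}^H)$ over $C^\infty({\cal R})$, with the sections $\sigma\in\Gamma({\cal A}^H)$. This bracket extends the bracket of $\Gamma({\cal A})$, is $\mathbb R$-linear in $\varepsilon$ and additive in $\sigma$, and satisfies $$\{h_\varepsilon,h_\sigma\}=h_{\lfloor\varepsilon,\sigma\rfloor},\qquad \lfloor\varepsilon,F\sigma\rfloor=F\lfloor\varepsilon,\sigma\rfloor+\{h_\varepsilon,F\}\,\sigma\qquad(F\in C^\infty({\cal R})).$$ 3. The Hamiltonians of every lift are linear in the momenta: in each local frame $e$ of ${\cal L}$, $h_\varepsilon=\langle p_e|\delta_\varepsilon\rangle+c_e(x;\varepsilon)$ with a smooth local section $c_e$ of ${\cal A}^*$. 4. For every open covering $U$ there is a bijection between the set of equivalence classes of lifts and $H^1({\cal A},V)$. It sends the class of $({\cal L},h)$ to the class of $(c_\alpha,c_{\alpha\beta})$ whenever ${\cal L}$ has frames $e_\alpha$ over $U_\alpha$ with $e_\alpha=\exp(c_{\alpha\beta})e_\beta$ and $h_\varepsilon=\langle p_\alpha|\delta_\varepsilon\rangle+c_\alpha(x;\varepsilon)$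 over $U_\alpha$. Every lift is given by some cocycle in this way, and every cocycle gives a lift. -/

import Mathlib

open Set Filter Topology Bundle
open scoped Manifold ContDiff

universe u v w

noncomputable section

/-! ### Lie algebroids and the first cohomology of the Čech bicomplex -/

/-- The coordinate space `ℝⁿ`. -/
abbrev Eucl (n : ℕ) : Type := EuclideanSpace ℝ (Fin n)

section Base

variable (n : ℕ) {V : Type u} [TopologicalSpace V] [ChartedSpace (Eucl n) V]

/-- The cotangent space `T*ₓV`. -/
abbrev Cotangent (x : V) : Type := TangentSpace (𝓡 n) x →L[ℝ] ℝ

/-- The differential `df_x ∈ T*ₓV` of a function on `V`. -/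
def diff (f : V → ℝ) (x : V) : Cotangent n x := mfderiv (𝓡 n) 𝓘(ℝ, ℝ) f x

/-- Smoothness of a function on a subset of `V`. -/
abbrev SmoothOn (f : V → ℝ) (s : Set V) : Prop := ContMDiffOn (𝓡 n) 𝓘(ℝ, ℝ) ∞ f s

end Base

section Algebroid

variable (n : ℕ) {V : Type u} [TopologicalSpace V] [ChartedSpace (Eucl n) V]
  (F : Type v) [NormedAddCommGroup F] [NormedSpace ℝ F]
  (A : V → Type w) [∀ x, AddCommGroup (A x)] [∀ x, Module ℝ (A x)]
  [∀ x, TopologicalSpace (A x)] [TopologicalSpace (TotalSpace F A)] [FiberBundle F A]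

/-- Global smooth sections `Γ(A)` of a vector bundle over `V`. -/
abbrev Sec : Type _ := ContMDiffSection (𝓡 n) F ∞ A

/-- The product `f ε` of a smooth function and a smooth section. -/
def fsmul [VectorBundle ℝ F A] (f : V → ℝ) (hf : ContMDiff (𝓡 n) 𝓘(ℝ, ℝ) ∞ f)
    (ε : Sec n F A) : Sec n F A :=
  ⟨fun x => f x • ε x, hf.smul_section ε.contMDiff⟩

/-- A Lie algebroid structure on the vector bundle `A → V`: a Lie bracket on `Γ(A)` and a bundle
map `δ : A → TV` with `[δ_ε₁, δ_ε₂] = δ_⌊ε₁,ε₂⌋` and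
`⌊ε₁, f ε₂⌋ = f ⌊ε₁, ε₂⌋ + (δ_ε₁ f) ε₂`. -/
structure LieAlgebroid [VectorBundle ℝ F A] [IsManifold (𝓡 n) ∞ V] where
  bracket : Sec n F A →ₗ[ℝ] Sec n F A →ₗ[ℝ] Sec n F A
  bracket_self : ∀ ε, bracket ε ε = 0
  jacobi : ∀ ε₁ ε₂ ε₃, bracket ε₁ (bracket ε₂ ε₃) + bracket ε₂ (bracket ε₃ ε₁)
    + bracket ε₃ (bracket ε₁ ε₂) = 0
  anchor : ∀ x : V, A x →ₗ[ℝ] TangentSpace (𝓡 n) x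
  anchor_smooth : ContMDiff ((𝓡 n).prod 𝓘(ℝ, F)) ((𝓡 n).prod 𝓘(ℝ, Eucl n)) ∞
    (fun a : TotalSpace F A => (⟨a.1, anchor a.1 a.2⟩ : TangentBundle (𝓡 n) V))
  anchor_bracket : ∀ (ε₁ ε₂ : Sec n F A) (x : V),
    VectorField.mlieBracket (𝓡 n) (fun y => anchor y (ε₁ y)) (fun y => anchor y (ε₂ y)) x
      = anchor x (bracket ε₁ ε₂ x)
  leibniz : ∀ (f : V → ℝ) (hf : ContMDiff (𝓡 n) 𝓘(ℝ, ℝ) ∞ f) (ε₁ ε₂ : Sec n F A) (x : V),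
    bracket ε₁ (fsmul n F A f hf ε₂) x
      = f x • bracket ε₁ ε₂ x + diff n f x (anchor x (ε₁ x)) • ε₂ x

variable {n F A} [VectorBundle ℝ F A] [IsManifold (𝓡 n) ∞ V]

/-- The derivative `δ_ε f` of a function along the anchor of a section. -/
def LieAlgebroid.der (𝒜 : LieAlgebroid n F A) (ε : Sec n F A) (f : V → ℝ) (x : V) : ℝ :=
  diff n f x (𝒜.anchor x (ε x))

theorem LieAlgebroid.der_add (𝒜 : LieAlgebroid n F A) (ε : Sec n F A) {f g : V → ℝ} {s : Set V}
    (hs : IsOpen s) (hf : SmoothOn n f s) (hg : SmoothOn n g s) {x : V} (hx : x ∈ s) :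
    𝒜.der ε (fun y => f y + g y) x = 𝒜.der ε f x + 𝒜.der ε g x := by
  have h1 : MDifferentiableAt (𝓡 n) 𝓘(ℝ, ℝ) f x :=
    (hf.contMDiffAt (hs.mem_nhds hx)).mdifferentiableAt (by simp)
  have h2 : MDifferentiableAt (𝓡 n) 𝓘(ℝ, ℝ) g x :=
    (hg.contMDiffAt (hs.mem_nhds hx)).mdifferentiableAt (by simp)
  have := mfderiv_add h1 h2
  change (mfderiv (𝓡 n) 𝓘(ℝ, ℝ) (f + g) x) _ = _
  rw [this]
  rfl

theorem LieAlgebroid.der_smul (𝒜 : LieAlgebroid n F A) (ε : Sec n F A) {f : V → ℝ} {s : Set V}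
    (hs : IsOpen s) (hf : SmoothOn n f s) (r : ℝ) {x : V} (hx : x ∈ s) :
    𝒜.der ε (fun y => r * f y) x = r * 𝒜.der ε f x := by
  have h1 : MDifferentiableAt (𝓡 n) 𝓘(ℝ, ℝ) f x :=
    (hf.contMDiffAt (hs.mem_nhds hx)).mdifferentiableAt (by simp)
  have := const_smul_mfderiv h1 r
  change (mfderiv (𝓡 n) 𝓘(ℝ, ℝ) (r • f) x) _ = _
  rw [this]
  rfl

theorem LieAlgebroid.der_const (𝒜 : LieAlgebroid n F A) (ε : Sec n F A) (r : ℝ) (x : V) :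
    𝒜.der ε (fun _ => r) x = 0 := by
  unfold LieAlgebroid.der diff
  rw [mfderiv_const]
  rfl

variable {ι : Type*}

variable (A ι) in
/-- Pairs `(c_α, c_αβ)` of a family of 1-cochains `c_α(x; a)`, `a ∈ A_x`, and a family of
functions `c_αβ(x)`. Only the values of `c_α` on `U_α` and of `c_αβ` on `U_α ∩ U_β` matter: the
values elsewhere are unconstrained and are divided out in `H1`. -/
def Cochain1 : Type _ := (ι → ∀ x : V, A x →ₗ[ℝ] ℝ) × (ι → ι → V → ℝ)

instance : AddCommGroup (Cochain1 A ι) :=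
  inferInstanceAs (AddCommGroup ((ι → ∀ x : V, A x →ₗ[ℝ] ℝ) × (ι → ι → V → ℝ)))

instance : Module ℝ (Cochain1 A ι) :=
  inferInstanceAs (Module ℝ ((ι → ∀ x : V, A x →ₗ[ℝ] ℝ) × (ι → ι → V → ℝ)))

/-- The family `c_α`. -/
def Cochain1.form (c : Cochain1 A ι) : ι → ∀ x : V, A x →ₗ[ℝ] ℝ := Prod.fst c

/-- The family `c_αβ`. -/
def Cochain1.fn (c : Cochain1 A ι) : ι → ι → V → ℝ := Prod.snd c

/-- The cocycles of total degree one of the Čech bicomplex of the covering `U`: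
`c_α ∈ Γ(U_α, A*)`, `c_αβ ∈ C^∞(U_α ∩ U_β)`,
`c_α(⌊ε₁,ε₂⌋) = δ_ε₁ c_α(ε₂) - δ_ε₂ c_α(ε₁)`, `δ_ε c_αβ = -c_α(ε) + c_β(ε)`,
`c_αγ = c_αβ + c_βγ`. -/
structure IsCocycle1 (𝒜 : LieAlgebroid n F A) (U : ι → TopologicalSpace.Opens V)
    (c : Cochain1 A ι) : Prop where
  smooth_form : ∀ i (ε : Sec n F A), SmoothOn n (fun x => c.form i x (ε x)) (U i)
  smooth_fun : ∀ i j, SmoothOn n (c.fn i j) (U i ∩ U j)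
  closed : ∀ i (ε₁ ε₂ : Sec n F A), ∀ x ∈ U i,
    c.form i x (𝒜.bracket ε₁ ε₂ x) = 𝒜.der ε₁ (fun y => c.form i y (ε₂ y)) x
      - 𝒜.der ε₂ (fun y => c.form i y (ε₁ y)) x
  compat : ∀ i j (ε : Sec n F A), ∀ x ∈ U i, x ∈ U j →
    𝒜.der ε (c.fn i j) x = - c.form i x (ε x) + c.form j x (ε x)
  cech : ∀ i j k, ∀ x ∈ U i, x ∈ U j → x ∈ U k → c.fn i k x = c.fn i j x + c.fn j k x

/-- The coboundaries: `c_α(ε) = δ_ε f_α` and `c_αβ = f_β - f_α` with `f_α ∈ C^∞(U_α)`. -/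
def IsCoboundary1 (𝒜 : LieAlgebroid n F A) (U : ι → TopologicalSpace.Opens V)
    (c : Cochain1 A ι) : Prop :=
  ∃ f : ι → V → ℝ, (∀ i, SmoothOn n (f i) (U i)) ∧
    (∀ i (ε : Sec n F A), ∀ x ∈ U i, c.form i x (ε x) = 𝒜.der ε (f i) x) ∧
    (∀ i j, ∀ x ∈ U i, x ∈ U j → c.fn i j x = f j x - f i x)

/-- The space of 1-cocycles. -/
def Z1 (𝒜 : LieAlgebroid n F A) (U : ι → TopologicalSpace.Opens V) :
    Submodule ℝ (Cochain1 A ι) where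
  carrier := {c | IsCocycle1 𝒜 U c}
  zero_mem' :=
    { smooth_form := fun _ _ => contMDiffOn_const
      smooth_fun := fun _ _ => contMDiffOn_const
      closed := fun i ε₁ ε₂ x _ => by
        change (0 : ℝ) = 𝒜.der ε₁ (fun _ => 0) x - 𝒜.der ε₂ (fun _ => 0) x
        simp [𝒜.der_const]
      compat := fun i j ε x _ _ => by
        change 𝒜.der ε (fun _ => 0) x = -0 + 0
        simp [𝒜.der_const]
      cech := fun _ _ _ _ _ _ _ => (add_zero (0 : ℝ)).symm }
  add_mem' := fun {a b} ha hb =>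
    { smooth_form := fun i ε => (ha.smooth_form i ε).add (hb.smooth_form i ε)
      smooth_fun := fun i j => (ha.smooth_fun i j).add (hb.smooth_fun i j)
      closed := fun i ε₁ ε₂ x hx => by
        have e1 := 𝒜.der_add ε₁ (U i).isOpen (ha.smooth_form i ε₂) (hb.smooth_form i ε₂) hx
        have e2 := 𝒜.der_add ε₂ (U i).isOpen (ha.smooth_form i ε₁) (hb.smooth_form i ε₁) hx
        have h1 := ha.closed i ε₁ ε₂ x hx
        have h2 := hb.closed i ε₁ ε₂ x hx
        change a.form i x (𝒜.bracket ε₁ ε₂ x) + b.form i x (𝒜.bracket ε₁ ε₂ x) =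
          𝒜.der ε₁ (fun y => a.form i y (ε₂ y) + b.form i y (ε₂ y)) x
            - 𝒜.der ε₂ (fun y => a.form i y (ε₁ y) + b.form i y (ε₁ y)) x
        rw [e1, e2, h1, h2]; ring
      compat := fun i j ε x hi hj => by
        have e1 := 𝒜.der_add ε ((U i).isOpen.inter (U j).isOpen) (ha.smooth_fun i j)
          (hb.smooth_fun i j) ⟨hi, hj⟩
        have h1 := ha.compat i j ε x hi hj
        have h2 := hb.compat i j ε x hi hj
        change 𝒜.der ε (fun y => a.fn i j y + b.fn i j y) x =
          -(a.form i x (ε x) + b.form i x (ε x)) + (a.form j x (ε x) + b.form j x (ε x))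
        rw [e1, h1, h2]; ring
      cech := fun i j k x hi hj hk => by
        have h1 := ha.cech i j k x hi hj hk
        have h2 := hb.cech i j k x hi hj hk
        change a.fn i k x + b.fn i k x = a.fn i j x + b.fn i j x + (a.fn j k x + b.fn j k x)
        rw [h1, h2]; ring }
  smul_mem' := fun r a ha =>
    { smooth_form := fun i ε => contMDiffOn_const.mul (ha.smooth_form i ε)
      smooth_fun := fun i j => contMDiffOn_const.mul (ha.smooth_fun i j)
      closed := fun i ε₁ ε₂ x hx => by
        have e1 := 𝒜.der_smul ε₁ (U i).isOpen (ha.smooth_form i ε₂) r hx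
        have e2 := 𝒜.der_smul ε₂ (U i).isOpen (ha.smooth_form i ε₁) r hx
        have h1 := ha.closed i ε₁ ε₂ x hx
        change r * a.form i x (𝒜.bracket ε₁ ε₂ x) =
          𝒜.der ε₁ (fun y => r * a.form i y (ε₂ y)) x - 𝒜.der ε₂ (fun y => r * a.form i y (ε₁ y)) x
        rw [e1, e2, h1]; ring
      compat := fun i j ε x hi hj => by
        have e1 := 𝒜.der_smul ε ((U i).isOpen.inter (U j).isOpen) (ha.smooth_fun i j) r ⟨hi, hj⟩
        have h1 := ha.compat i j ε x hi hj
        change 𝒜.der ε (fun y => r * a.fn i j y) x = -(r * a.form i x (ε x)) + r * a.form j x (ε x)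
        rw [e1, h1]; ring
      cech := fun i j k x hi hj hk => by
        have h1 := ha.cech i j k x hi hj hk
        change r * a.fn i k x = r * a.fn i j x + r * a.fn j k x
        rw [h1]; ring }

/-- The space of 1-coboundaries. -/
def B1 (𝒜 : LieAlgebroid n F A) (U : ι → TopologicalSpace.Opens V) :
    Submodule ℝ (Cochain1 A ι) where
  carrier := {c | IsCoboundary1 𝒜 U c}
  zero_mem' := by
    refine ⟨fun _ _ => 0, fun _ => contMDiffOn_const, fun i ε x _ => ?_, fun i j x _ _ => ?_⟩
    · rw [𝒜.der_const]; rfl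
    · exact (sub_zero (0 : ℝ)).symm
  add_mem' := by
    rintro a b ⟨f, hf, hf1, hf2⟩ ⟨g, hg, hg1, hg2⟩
    refine ⟨fun i x => f i x + g i x, fun i => (hf i).add (hg i), fun i ε x hx => ?_,
      fun i j x hi hj => ?_⟩
    · rw [𝒜.der_add ε (U i).isOpen (hf i) (hg i) hx, ← hf1 i ε x hx, ← hg1 i ε x hx]; rfl
    · change a.fn i j x + b.fn i j x = _
      rw [hf2 i j x hi hj, hg2 i j x hi hj]; ring
  smul_mem' := by
    rintro r a ⟨f, hf, hf1, hf2⟩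
    refine ⟨fun i x => r * f i x, fun i => contMDiffOn_const.mul (hf i), fun i ε x hx => ?_,
      fun i j x hi hj => ?_⟩
    · rw [𝒜.der_smul ε (U i).isOpen (hf i) r hx, ← hf1 i ε x hx]; rfl
    · change r * a.fn i j x = _
      rw [hf2 i j x hi hj]; ring

/-- The cohomology `H¹(A, V)`, computed with the Čech bicomplex of the covering `U`. -/
abbrev H1 (𝒜 : LieAlgebroid n F A) (U : ι → TopologicalSpace.Opens V) : Type _ :=
  Z1 𝒜 U ⧸ (B1 𝒜 U).comap (Z1 𝒜 U).subtype

end Algebroid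

/-! ### Line bundles with transition functions `exp c_αβ` and their connections -/

section LineBundles

variable (n : ℕ) (V : Type u) [TopologicalSpace V] [ChartedSpace (Eucl n) V]

/-- A smooth real line bundle over `V`. -/
structure LineBundle where
  fiber : V → Type
  [addCommGroup : ∀ x, AddCommGroup (fiber x)]
  [module : ∀ x, Module ℝ (fiber x)]
  [topology : ∀ x, TopologicalSpace (fiber x)]
  [topologyTotal : TopologicalSpace (TotalSpace ℝ fiber)]
  [fiberBundle : FiberBundle ℝ fiber]
  [vectorBundle : VectorBundle ℝ ℝ fiber]
  [smooth : ContMDiffVectorBundle ∞ ℝ fiber (𝓡 n)]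

attribute [instance] LineBundle.addCommGroup LineBundle.module LineBundle.topology
  LineBundle.topologyTotal LineBundle.fiberBundle LineBundle.vectorBundle LineBundle.smooth

variable {n V}

/-- A nowhere vanishing smooth section of `L` over an open set `dom`, i.e. a local trivialization
(the values outside `dom` are irrelevant). -/
structure Frame (L : LineBundle n V) where
  dom : TopologicalSpace.Opens V
  sec : ∀ x, L.fiber x
  smooth : ContMDiffOn (𝓡 n) ((𝓡 n).prod 𝓘(ℝ, ℝ)) ∞
    (fun x => (⟨x, sec x⟩ : TotalSpace ℝ L.fiber)) dom
  ne_zero : ∀ x ∈ dom, sec x ≠ 0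

variable (n V) in
/-- A line bundle that is given by transition functions of the form `exp c_αβ`: it has local
frames over the members of an open covering any two of which differ by a positive factor. -/
structure ExpLineBundle extends LineBundle n V where
  exists_frames : ∃ S : Set (Frame toLineBundle), (∀ x, ∃ e ∈ S, x ∈ e.dom) ∧
    ∀ e ∈ S, ∀ e' ∈ S, ∀ x ∈ e.dom, x ∈ e'.dom → ∃ t : ℝ, e'.sec x = Real.exp t • e.sec x

/-- A connection at the point `x` on the line bundle `L`, given by its connection forms
`p_e ∈ T*ₓV`, `∇e = p_e ⊗ e`, in all the local frames `e` around `x`; if `e' = g e` near `x` then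
`p_e' = p_e + dg / g`. -/
@[ext]
structure ConnAt (L : LineBundle n V) (x : V) where
  form : ∀ e : Frame L, x ∈ e.dom → Cotangent n x
  gauge : ∀ (e e' : Frame L) (h : x ∈ e.dom) (h' : x ∈ e'.dom) (g : V → ℝ),
    (∀ᶠ y in 𝓝 x, e'.sec y = g y • e.sec y) → form e' h' = form e h + (g x)⁻¹ • diff n g x

/-- The total space of the bundle `R = Conn(L)` over `V`. -/
abbrev Conn (L : LineBundle n V) : Type u := Σ x : V, ConnAt L x

/-- The action `∇ ↦ ∇ + ξ` of the cotangent space on connections. -/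
instance (L : LineBundle n V) (x : V) : VAdd (Cotangent n x) (ConnAt L x) where
  vadd ξ D := ⟨fun e h => ξ + D.form e h, fun e e' h h' g hg => by
    rw [D.gauge e e' h h' g hg, add_assoc]⟩

section Ratio

variable {L : LineBundle n V}

/-- The quotient `σ / e` of two sections of `L`, computed in the trivialization of `L` at `x`. -/
def ratio (x : V) (e σ : ∀ y, L.fiber y) (y : V) : ℝ :=
  (trivializationAt ℝ L.fiber x ⟨y, σ y⟩).2 / (trivializationAt ℝ L.fiber x ⟨y, e y⟩).2

theorem triv_ne_zero (x : V) {y : V} (hy : y ∈ (trivializationAt ℝ L.fiber x).baseSet)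
    {v : L.fiber y} (hv : v ≠ 0) : (trivializationAt ℝ L.fiber x ⟨y, v⟩).2 ≠ 0 := by
  have h : (trivializationAt ℝ L.fiber x ⟨y, v⟩).2
      = (trivializationAt ℝ L.fiber x).linearEquivAt ℝ y hy v := rfl
  rw [h]
  exact ((trivializationAt ℝ L.fiber x).linearEquivAt ℝ y hy).map_ne_zero_iff.2 hv

theorem triv_smul (x : V) {y : V} (hy : y ∈ (trivializationAt ℝ L.fiber x).baseSet)
    (r : ℝ) (v : L.fiber y) : (trivializationAt ℝ L.fiber x ⟨y, r • v⟩).2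
      = r * (trivializationAt ℝ L.fiber x ⟨y, v⟩).2 := by
  have h : ∀ v : L.fiber y, (trivializationAt ℝ L.fiber x ⟨y, v⟩).2
      = (trivializationAt ℝ L.fiber x).linearEquivAt ℝ y hy v := fun _ => rfl
  rw [h, h, map_smul]
  rfl

theorem contMDiffAt_triv {x : V} (e : Frame L) (h : x ∈ e.dom) :
    ContMDiffAt (𝓡 n) 𝓘(ℝ, ℝ) ∞ (fun y => (trivializationAt ℝ L.fiber x ⟨y, e.sec y⟩).2) x :=
  (contMDiffAt_section (s := e.sec) x).1 (e.smooth.contMDiffAt (e.dom.isOpen.mem_nhds h))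

theorem contMDiffAt_ratio {x : V} (e e' : Frame L) (h : x ∈ e.dom) (h' : x ∈ e'.dom) :
    ContMDiffAt (𝓡 n) 𝓘(ℝ, ℝ) ∞ (ratio x e.sec e'.sec) x :=
  (contMDiffAt_triv e' h').div₀ (contMDiffAt_triv e h)
    (triv_ne_zero x (FiberBundle.mem_baseSet_trivializationAt' x) (e.ne_zero x h))

end Ratio

/-- The connection `∇` at `x` with connection form `ξ` in the frame `e`. -/
def ConnAt.ofForm {L : LineBundle n V} (e : Frame L) {x : V} (hx : x ∈ e.dom)
    (ξ : Cotangent n x) : ConnAt L x where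
  form e' _ := ξ + (ratio x e.sec e'.sec x)⁻¹ • diff n (ratio x e.sec e'.sec) x
  gauge := by
    intro e₁ e₂ h₁ h₂ g hg
    set t := trivializationAt ℝ L.fiber x with ht
    have hb : ∀ᶠ y in 𝓝 x, y ∈ t.baseSet :=
      t.open_baseSet.mem_nhds (FiberBundle.mem_baseSet_trivializationAt' x)
    have hxb : x ∈ t.baseSet := FiberBundle.mem_baseSet_trivializationAt' x
    have hr : ratio x e.sec e₂.sec =ᶠ[𝓝 x] fun y => g y * ratio x e.sec e₁.sec y := by
      filter_upwards [hg, hb] with y hy hyb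
      unfold ratio
      rw [hy, triv_smul x hyb, mul_div_assoc]
    have hgr : g =ᶠ[𝓝 x] ratio x e₁.sec e₂.sec := by
      filter_upwards [hg, hb, e₁.dom.isOpen.mem_nhds h₁] with y hy hyb hyd
      unfold ratio
      rw [hy, triv_smul x hyb, mul_div_assoc, div_self (triv_ne_zero x hyb (e₁.ne_zero y hyd)),
        mul_one]
    have dg : MDifferentiableAt (𝓡 n) 𝓘(ℝ, ℝ) g x :=
      ((contMDiffAt_ratio e₁ e₂ h₁ h₂).congr_of_eventuallyEq hgr).mdifferentiableAt (by simp)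
    have dr : MDifferentiableAt (𝓡 n) 𝓘(ℝ, ℝ) (ratio x e.sec e₁.sec) x :=
      (contMDiffAt_ratio e e₁ hx h₁).mdifferentiableAt (by simp)
    have g0 : g x ≠ 0 := by
      rw [hgr.self_of_nhds]
      exact div_ne_zero (triv_ne_zero x hxb (e₂.ne_zero x h₂))
        (triv_ne_zero x hxb (e₁.ne_zero x h₁))
    have r0 : ratio x e.sec e₁.sec x ≠ 0 :=
      div_ne_zero (triv_ne_zero x hxb (e₁.ne_zero x h₁)) (triv_ne_zero x hxb (e.ne_zero x hx))
    have key : diff n (ratio x e.sec e₂.sec) x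
        = g x • diff n (ratio x e.sec e₁.sec) x + ratio x e.sec e₁.sec x • diff n g x := by
      unfold diff
      rw [hr.mfderiv_eq]
      exact (dg.hasMFDerivAt.mul dr.hasMFDerivAt).mfderiv
    rw [key, hr.self_of_nhds, add_assoc]
    congr 1
    rw [smul_add, smul_smul, smul_smul]
    congr 2 <;> field_simp

/-- The frame given by the local trivialization of `L` at `x`. -/
def stdFrame [IsManifold (𝓡 n) ∞ V] (L : LineBundle n V) (x : V) : Frame L where
  dom := ⟨(trivializationAt ℝ L.fiber x).baseSet, (trivializationAt ℝ L.fiber x).open_baseSet⟩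
  sec := (trivializationAt ℝ L.fiber x).localFrame (Module.Basis.singleton Unit ℝ) ()
  smooth := (trivializationAt ℝ L.fiber x).contMDiffOn_localFrame_baseSet ∞
    (Module.Basis.singleton Unit ℝ) ()
  ne_zero _ hy := ((trivializationAt ℝ L.fiber x).isLocalFrameOn_localFrame_baseSet (𝓡 n) ∞
    (Module.Basis.singleton Unit ℝ)).linearIndependent hy |>.ne_zero ()

theorem mem_stdFrame [IsManifold (𝓡 n) ∞ V] (L : LineBundle n V) (x : V) :
    x ∈ (stdFrame L x).dom :=
  FiberBundle.mem_baseSet_trivializationAt' x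

end LineBundles

/-! ### The symplectic structure of `R = Conn(L)` -/

section Symplectic

/-- The coordinate phase space: pairs `(x, p)` of a point and a covector of `ℝⁿ`. -/
abbrev Phase (n : ℕ) : Type := Eucl n × (Eucl n →L[ℝ] ℝ)

variable {n : ℕ}

/-- The coordinate vector `∂/∂x_a`. -/
def dirX (a : Fin n) : Phase n := (EuclideanSpace.single a 1, 0)

/-- The coordinate vector `∂/∂p_a`. -/
def dirP (a : Fin n) : Phase n := (0, EuclideanSpace.proj a)

/-- The canonical symplectic form `dp ∧ dx` on the coordinate phase space. -/
def canonicalForm (v w : Phase n) : ℝ := v.2 w.1 - w.2 v.1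

/-- The Hamiltonian vector field of `f`, with `x_a`-components `-∂f/∂p_a` and `p_a`-components
`∂f/∂x_a`; it satisfies `i_f ω = df`, see `canonicalForm_hamVec`. -/
def hamVec (f : Phase n → ℝ) (z : Phase n) : Phase n :=
  ∑ a, (fderiv ℝ f z (dirX a) • dirP a - fderiv ℝ f z (dirP a) • dirX a)

/-- The Poisson bracket `{f, g} = - i_f dg`. -/
def poissonCoord (f g : Phase n → ℝ) (z : Phase n) : ℝ := - fderiv ℝ g z (hamVec f z)

theorem phase_eq_sum (w : Phase n) :
    w = ∑ a, (w.1 a • dirX a + w.2 (EuclideanSpace.single a 1) • dirP a) := by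
  have h1 : ∀ y : Eucl n, y = ∑ a, y a • EuclideanSpace.single a (1 : ℝ) := by
    intro y
    ext i
    simp [Finset.sum_apply, Pi.single_apply]
  refine Prod.ext ?_ (ContinuousLinearMap.ext fun y => ?_)
  · conv_lhs => rw [h1 w.1]
    simp [Prod.fst_sum, dirX, dirP]
  · conv_lhs => rw [h1 y]
    simp [Prod.snd_sum, dirX, dirP, mul_comm]

theorem canonicalForm_hamVec (f : Phase n → ℝ) (z w : Phase n) :
    canonicalForm (hamVec f z) w = fderiv ℝ f z w := by
  conv_rhs => rw [phase_eq_sum w]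
  simp only [map_sum, map_add, map_smul, Finset.sum_add_distrib]
  simp [canonicalForm, hamVec, Prod.fst_sum, Prod.snd_sum, dirX, dirP, mul_comm]

theorem poissonCoord_eq (f g : Phase n → ℝ) (z : Phase n) :
    poissonCoord f g z = ∑ a, (fderiv ℝ f z (dirP a) * fderiv ℝ g z (dirX a)
      - fderiv ℝ f z (dirX a) * fderiv ℝ g z (dirP a)) := by
  simp [poissonCoord, hamVec]

variable {V : Type u} [TopologicalSpace V] [ChartedSpace (Eucl n) V] [IsManifold (𝓡 n) ∞ V]

section Darboux

variable {L : LineBundle n V}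

open Classical in
/-- The inverse of the Darboux chart of `R` that belongs to a chart `φ` of `V` and a frame `e`
of `L`: it sends `(q, p)` to the connection over `x = φ⁻¹(q)` with connection form
`∑ p_a dφ_a` in the frame `e` (and has an irrelevant value if `(q, p)` is not in
`darbouxTarget φ e`). -/
def darboux (φ : OpenPartialHomeomorph V (Eucl n)) (e : Frame L) (z : Phase n) : Conn L :=
  ⟨φ.symm z.1,
    if h : φ.symm z.1 ∈ e.dom then
      ConnAt.ofForm e h (z.2.comp (mfderiv (𝓡 n) (𝓡 n) φ (φ.symm z.1)))
    else ConnAt.ofForm (stdFrame L _) (mem_stdFrame L _) 0⟩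

/-- The image of the Darboux chart that belongs to `φ` and `e`. -/
def darbouxTarget (φ : OpenPartialHomeomorph V (Eucl n)) (e : Frame L) : Set (Phase n) :=
  {z | z.1 ∈ φ.target ∧ φ.symm z.1 ∈ e.dom}

/-- The Darboux coordinates of a point of `R`. -/
def darbouxCoord (φ : OpenPartialHomeomorph V (Eucl n)) (e : Frame L) (r : Conn L)
    (h : r.1 ∈ e.dom) : Phase n :=
  (φ r.1, (r.2.form e h).comp (mfderiv (𝓡 n) (𝓡 n) φ.symm (φ r.1)))

/-- Smooth functions on `R`: those that are smooth in all the Darboux charts. -/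
def SmoothFun (f : Conn L → ℝ) : Prop :=
  ∀ φ ∈ atlas (Eucl n) V, ∀ e : Frame L,
    ContDiffOn ℝ ∞ (fun z => f (darboux φ e z)) (darbouxTarget φ e)

/-- The Poisson bracket on `R`. Two Darboux charts differ by a symplectic transformation, so the
bracket at `r` may be computed in any of them. -/
def poisson (f g : Conn L → ℝ) (r : Conn L) : ℝ :=
  poissonCoord (fun z => f (darboux (chartAt (Eucl n) r.1) (stdFrame L r.1) z))
    (fun z => g (darboux (chartAt (Eucl n) r.1) (stdFrame L r.1) z))
    (darbouxCoord (chartAt (Eucl n) r.1) (stdFrame L r.1) r (mem_stdFrame L r.1))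

end Darboux

variable {F : Type v} [NormedAddCommGroup F] [NormedSpace ℝ F]
  {A : V → Type w} [∀ x, AddCommGroup (A x)] [∀ x, Module ℝ (A x)]
  [∀ x, TopologicalSpace (A x)] [TopologicalSpace (TotalSpace F A)] [FiberBundle F A]

variable (F) in
/-- Smooth sections over `R` of the pull-back `π*A` of a vector bundle `A → V` along the
projection `π : R → V`. -/
def SmoothSec {L : LineBundle n V} (σ : ∀ r : Conn L, A r.1) : Prop :=
  ∀ φ ∈ atlas (Eucl n) V, ∀ e : Frame L,
    ContMDiffOn 𝓘(ℝ, Phase n) ((𝓡 n).prod 𝓘(ℝ, F)) ∞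
      (fun z => (⟨(darboux φ e z).1, σ (darboux φ e z)⟩ : TotalSpace F A)) (darbouxTarget φ e)

end Symplectic

/-! ### Hamiltonian algebroids and lifts of the anchor -/

section Lifts

variable {n : ℕ} {V : Type u} [TopologicalSpace V] [ChartedSpace (Eucl n) V]
  [IsManifold (𝓡 n) ∞ V]
  {F : Type v} [NormedAddCommGroup F] [NormedSpace ℝ F]
  {A : V → Type w} [∀ x, AddCommGroup (A x)] [∀ x, Module ℝ (A x)]
  [∀ x, TopologicalSpace (A x)] [TopologicalSpace (TotalSpace F A)] [FiberBundle F A]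
  [VectorBundle ℝ F A]

/-- A Hamiltonian action on `R = Conn(L)` that lifts the anchor action of `𝒜`: every `ε ∈ Γ(A)`
has a Hamiltonian `h_ε ∈ C^∞(R)`, depending on `ε` through a bundle map; the canonical
transformation `{h_ε, ·}` covers `δ_ε`; and `{h_ε₁, h_ε₂} = h_⌊ε₁,ε₂⌋`. -/
structure HamLift (𝒜 : LieAlgebroid n F A) (L : LineBundle n V) where
  ham : ∀ r : Conn L, A r.1 →ₗ[ℝ] ℝ
  ham_smooth : ∀ ε : Sec n F A, SmoothFun (fun r : Conn L => ham r (ε r.1))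
  covers : ∀ (ε : Sec n F A) (f : V → ℝ), ContMDiff (𝓡 n) 𝓘(ℝ, ℝ) ∞ f → ∀ r : Conn L,
    poisson (fun s : Conn L => ham s (ε s.1)) (fun s => f s.1) r = 𝒜.der ε f r.1
  ham_bracket : ∀ (ε₁ ε₂ : Sec n F A) (r : Conn L),
    poisson (fun s : Conn L => ham s (ε₁ s.1)) (fun s => ham s (ε₂ s.1)) r
      = ham r (𝒜.bracket ε₁ ε₂ r.1)

variable (n F A) in
/-- The structure of a Hamiltonian algebroid on the pull-back bundle `A^H = π*A` over
`R = Conn(L)`: a bundle map `ε ↦ h_ε` and a bracket `⌊ε, σ⌋` of the sections `ε ∈ Γ(A)`, which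
generate `Γ(A^H)` over `C^∞(R)`, with all the sections `σ ∈ Γ(A^H)`. -/
structure HamiltonianAlgebroid (L : LineBundle n V) where
  ham : ∀ r : Conn L, A r.1 →ₗ[ℝ] ℝ
  ham_smooth : ∀ σ : (∀ r : Conn L, A r.1), SmoothSec F σ → SmoothFun (fun r => ham r (σ r))
  bracket : Sec n F A → (∀ r : Conn L, A r.1) → ∀ r : Conn L, A r.1
  bracket_smooth : ∀ ε σ, SmoothSec F σ → SmoothSec F (bracket ε σ)
  bracket_add_left : ∀ (ε₁ ε₂ : Sec n F A) σ, SmoothSec F σ →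
    bracket (ε₁ + ε₂) σ = bracket ε₁ σ + bracket ε₂ σ
  bracket_smul_left : ∀ (t : ℝ) (ε : Sec n F A) σ, SmoothSec F σ →
    bracket (t • ε) σ = t • bracket ε σ
  bracket_add_right : ∀ ε σ₁ σ₂, SmoothSec F σ₁ → SmoothSec F σ₂ →
    bracket ε (σ₁ + σ₂) = bracket ε σ₁ + bracket ε σ₂
  antisymm : ∀ ε₁ ε₂ : Sec n F A, bracket ε₁ (fun r => ε₂ r.1) = - bracket ε₂ (fun r => ε₁ r.1)
  ham_bracket : ∀ ε σ, SmoothSec F σ → ∀ r : Conn L,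
    poisson (fun s : Conn L => ham s (ε s.1)) (fun s => ham s (σ s)) r = ham r (bracket ε σ r)
  leibniz : ∀ ε σ (f : Conn L → ℝ), SmoothSec F σ → SmoothFun f → ∀ r : Conn L,
    bracket ε (fun s => f s • σ s) r
      = f r • bracket ε σ r + poisson (fun s : Conn L => ham s (ε s.1)) f r • σ r

/-- An isomorphism of line bundles over the identity of `V`. -/
structure LineIso (L L' : LineBundle n V) where
  toEquiv : ∀ x, L.fiber x ≃ₗ[ℝ] L'.fiber x
  smooth_to : ContMDiff ((𝓡 n).prod 𝓘(ℝ, ℝ)) ((𝓡 n).prod 𝓘(ℝ, ℝ)) ∞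
    (fun v : TotalSpace ℝ L.fiber => (⟨v.1, toEquiv v.1 v.2⟩ : TotalSpace ℝ L'.fiber))
  smooth_inv : ContMDiff ((𝓡 n).prod 𝓘(ℝ, ℝ)) ((𝓡 n).prod 𝓘(ℝ, ℝ)) ∞
    (fun v : TotalSpace ℝ L'.fiber => (⟨v.1, (toEquiv v.1).symm v.2⟩ : TotalSpace ℝ L.fiber))

namespace LineIso

variable {L L' L'' : LineBundle n V}

/-- The identity. -/
def refl (L : LineBundle n V) : LineIso L L := ⟨fun _ => .refl _ _, contMDiff_id, contMDiff_id⟩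

/-- The inverse isomorphism. -/
def symm (Φ : LineIso L L') : LineIso L' L :=
  ⟨fun x => (Φ.toEquiv x).symm, Φ.smooth_inv, Φ.smooth_to⟩

/-- The composition of isomorphisms. -/
def trans (Φ : LineIso L L') (Ψ : LineIso L' L'') : LineIso L L'' :=
  ⟨fun x => (Φ.toEquiv x).trans (Ψ.toEquiv x), Ψ.smooth_to.comp Φ.smooth_to,
    Φ.smooth_inv.comp Ψ.smooth_inv⟩

/-- The frame `Φ⁻¹(e')` of `L`. -/
def pullFrame (Φ : LineIso L L') (e : Frame L') : Frame L where
  dom := e.dom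
  sec x := (Φ.toEquiv x).symm (e.sec x)
  smooth := Φ.smooth_inv.comp_contMDiffOn e.smooth
  ne_zero x hx := by simpa using e.ne_zero x hx

/-- The map `Conn(L) → Conn(L')` induced by `Φ : L ≅ L'`. -/
def mapConn (Φ : LineIso L L') {x : V} (D : ConnAt L x) : ConnAt L' x where
  form e h := D.form (Φ.pullFrame e) h
  gauge e e' h h' g hg := D.gauge (Φ.pullFrame e) (Φ.pullFrame e') h h' g
    (hg.mono fun y hy => by simp [pullFrame, hy])

end LineIso

/-- A lift of the anchor action of `𝒜` to an affinization `R = Conn(L)` of `T*V`. -/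
structure Lift (𝒜 : LieAlgebroid n F A) extends ExpLineBundle n V where
  lift : HamLift 𝒜 toLineBundle

/-- Two lifts are equivalent if an isomorphism of the line bundles, i.e. a shift of the momenta by
the logarithmic derivatives of nowhere vanishing functions, takes the Hamiltonians of the first
to those of the second. -/
def Lift.Equivalent {𝒜 : LieAlgebroid n F A} (ℓ ℓ' : Lift 𝒜) : Prop :=
  ∃ Φ : LineIso ℓ.toLineBundle ℓ'.toLineBundle, ∀ (x : V) (D : ConnAt ℓ.toLineBundle x) (a : A x),
    ℓ'.lift.ham ⟨x, Φ.mapConn D⟩ a = ℓ.lift.ham ⟨x, D⟩ a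

/-- The equivalence relation on lifts. -/
instance Lift.setoid (𝒜 : LieAlgebroid n F A) : Setoid (Lift 𝒜) where
  r := Lift.Equivalent
  iseqv :=
    { refl := fun _ => ⟨LineIso.refl _, fun _ _ _ => rfl⟩
      symm := fun {a b} ⟨Φ, h⟩ => ⟨Φ.symm, fun x D v => by
        rw [← h x (Φ.symm.mapConn D) v]
        congr 2
        congr 1
        ext e he
        simp only [LineIso.mapConn, LineIso.pullFrame, LineIso.symm, LinearEquiv.symm_symm,
          LinearEquiv.apply_symm_apply]⟩
      trans := fun {a b c} ⟨Φ, h⟩ ⟨Ψ, h'⟩ => ⟨Φ.trans Ψ, fun x D v => by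
        rw [← h x D v, ← h' x (Φ.mapConn D) v]; rfl⟩ }

/-- The set of equivalence classes of lifts. -/
abbrev LiftClass (𝒜 : LieAlgebroid n F A) : Type _ := Quotient (Lift.setoid 𝒜)

/-- In the frames `e_α` of `L` over the members of the covering `U`, the line bundle of the lift
has the transition functions `e_α = exp(c_αβ) e_β` and the lift has the Hamiltonians
`h_a = ⟨p_α | δ_a⟩ + c_α(x; a)`, where `p_α` is the connection form in the frame `e_α`. -/
structure Lift.IsGivenBy {𝒜 : LieAlgebroid n F A} {ι : Type*} {U : ι → TopologicalSpace.Opens V}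
    (ℓ : Lift 𝒜) (c : Cochain1 A ι) (e : ι → Frame ℓ.toLineBundle) (he : ∀ i, (e i).dom = U i) :
    Prop where
  transition : ∀ i j, ∀ x ∈ U i, x ∈ U j →
    (e i).sec x = Real.exp (c.fn i j x) • (e j).sec x
  ham_eq : ∀ i x (hx : x ∈ (e i).dom) (D : ConnAt ℓ.toLineBundle x) (a : A x),
    ℓ.lift.ham ⟨x, D⟩ a = D.form (e i) hx (𝒜.anchor x a) + c.form i x a

end Lifts

end

/-!
Since the transition functions `exp(c_αβ)` of `L` are positive, a partition of unity glues the local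
frames to a global one (`ExpLineBundle.exists_global_frame`). In it the Hamiltonians
`h_ε = ⟨p|δ_ε⟩` are a lift, which is the case `c = 0` of `HamLift.ofLocal`: Hamiltonians of the local
form `⟨p_e|δ_ε⟩ + c_e(ε)` with closed `c_e` are a lift. The reason is the identity
`{⟨p|X⟩ + c, ⟨p|Y⟩ + d} = ⟨p|[X, Y]⟩ + X d - Y c` (`poisson_of_linear`), where the Poisson bracket
may be computed in any Darboux chart (`poisson_eq`), because a change of the chart of `V` and of the
frame of `L` acts on `(x, p)` by a symplectic transformation (`exists_symplectic_fderiv`).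

Conversely, let `h` be a lift. The condition `{h_ε, π^* f} = π^* (δ_ε f)` says that the derivative of
`h_ε` in the direction `ξ` of the momenta is `⟨ξ|δ_ε⟩` (`HamLift.fderiv_ham_momentum`), so that
`h_ε - ⟨p_e|δ_ε⟩` is constant on each fibre of `R`. This is the local form of the Hamiltonians
(`HamLift.ham_eq`), and `poisson_of_linear` turns `{h_ε₁, h_ε₂} = h_⌊ε₁,ε₂⌋` into the cocycle equation
of `c_e` (`HamLift.potential_closed`).

The bracket of the Hamiltonian algebroid is `⌊ε, ∑ f_i ε_i⌋ = ∑ (f_i ⌊ε, ε_i⌋ + {h_ε, f_i} ε_i)` in a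
local frame `ε_i` of sections of `A`. It does not depend on the local expression
(`HamLift.pullbackBracket_eq`), as both the bracket of `A` and `{h_ε, ·}` are derivations over `δ_ε` on
functions on `V`; its properties then follow from those of the Poisson bracket.

In the classification, a partition of unity gives `c_αβ = f_α - f_β` for a cocycle
(`exists_sub_eq_of_cocycle`), so that the cocycle belongs to a lift on the trivial line bundle with
the frames `exp(f_α)` (`Lift.exists_of_cocycle`). In every lift, the restrictions of a global frame
exhibit a cocycle (`Lift.exists_isGivenBy`). An isomorphism of two line bundles that matches the lifts
has the form `e_α ↦ ± exp(-f_α) e'_α`, and comparing the Hamiltonians and the transition functions in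
these frames shows that it exists if and only if the cocycles differ by the coboundary of `f_α`
(`Lift.Equivalent.isCoboundary1`, `Lift.IsGivenBy.equivalent`).
-/

noncomputable section

/-! ### Poisson brackets on phase space -/

section PhaseCalculus

variable {n : ℕ}

theorem poissonCoord_congr {f f' g g' : Phase n → ℝ} {z : Phase n} (hf : f =ᶠ[𝓝 z] f')
    (hg : g =ᶠ[𝓝 z] g') : poissonCoord f g z = poissonCoord f' g' z := by
  simp only [poissonCoord, hamVec, hf.fderiv_eq, hg.fderiv_eq]

/-- The canonical form is nondegenerate. -/
theorem eq_of_canonicalForm_eq {v v' : Phase n}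
    (h : ∀ w, canonicalForm v w = canonicalForm v' w) : v = v' := by
  refine Prod.ext ?_ (ContinuousLinearMap.ext fun u => ?_)
  · ext a
    have := h (0, EuclideanSpace.proj a)
    simpa [canonicalForm] using this
  · have := h (u, 0)
    simpa [canonicalForm] using this

/-- A linear map that preserves the canonical form is surjective. -/
theorem surjective_of_symplectic {T' : Phase n →L[ℝ] Phase n}
    (hT : ∀ v w, canonicalForm (T' v) (T' w) = canonicalForm v w) : Function.Surjective T' := by
  have hi : Function.Injective (T' : Phase n →ₗ[ℝ] Phase n) := by
    intro v v' hv
    refine eq_of_canonicalForm_eq fun w => ?_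
    rw [← hT v w, ← hT v' w]
    congr 1
  exact LinearMap.injective_iff_surjective.1 hi

/-- The Poisson bracket is invariant under symplectic transformations. -/
theorem poissonCoord_comp {T : Phase n → Phase n} {T' : Phase n →L[ℝ] Phase n} {z : Phase n}
    (hT : HasFDerivAt T T' z) (hs : ∀ v w, canonicalForm (T' v) (T' w) = canonicalForm v w)
    {f g : Phase n → ℝ} (hf : DifferentiableAt ℝ f (T z)) (hg : DifferentiableAt ℝ g (T z)) :
    poissonCoord (fun y => f (T y)) (fun y => g (T y)) z = poissonCoord f g (T z) := by
  have ef : fderiv ℝ (fun y => f (T y)) z = (fderiv ℝ f (T z)).comp T' :=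
    (hf.hasFDerivAt.comp z hT).fderiv
  have eg : fderiv ℝ (fun y => g (T y)) z = (fderiv ℝ g (T z)).comp T' :=
    (hg.hasFDerivAt.comp z hT).fderiv
  have key : T' (hamVec (fun y => f (T y)) z) = hamVec f (T z) := by
    refine eq_of_canonicalForm_eq fun w => ?_
    obtain ⟨w, rfl⟩ := surjective_of_symplectic hs w
    rw [hs, canonicalForm_hamVec, canonicalForm_hamVec, ef]
    rfl
  unfold poissonCoord
  rw [eg, ← key]
  rfl

/-- The derivative of the transition map `(q, p) ↦ (ψ(q), (p + dl(q)) ∘ dχ(ψ(q)))`, `χ = ψ⁻¹`,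
between two Darboux charts is symplectic: `p dq` changes by the closed form `dl`. -/
theorem exists_symplectic_fderiv {ψ χ : Eucl n → Eucl n} {l : Eucl n → ℝ} {q : Eucl n}
    (hψ : ContDiffAt ℝ ∞ ψ q) (hχ : ContDiffAt ℝ ∞ χ (ψ q)) (hl : ContDiffAt ℝ ∞ l q)
    (hinv : ∀ᶠ y in 𝓝 q, χ (ψ y) = y) (p : Eucl n →L[ℝ] ℝ) :
    ∃ T' : Phase n →L[ℝ] Phase n,
      HasFDerivAt (fun z : Phase n => (ψ z.1, (z.2 + fderiv ℝ l z.1).comp (fderiv ℝ χ (ψ z.1))))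
        T' (q, p) ∧
      ∀ v w, canonicalForm (T' v) (T' w) = canonicalForm v w := by
  have dψ : HasFDerivAt ψ (fderiv ℝ ψ q) q := (hψ.differentiableAt (by simp)).hasFDerivAt
  have dχ : HasFDerivAt (fderiv ℝ χ) (fderiv ℝ (fderiv ℝ χ) (ψ q)) (ψ q) :=
    ((hχ.fderiv_right (m := ∞) le_rfl).differentiableAt (by simp)).hasFDerivAt
  have dl : HasFDerivAt (fderiv ℝ l) (fderiv ℝ (fderiv ℝ l) q) q :=
    ((hl.fderiv_right (m := ∞) le_rfl).differentiableAt (by simp)).hasFDerivAt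
  have d1 : HasFDerivAt (fun z : Phase n => ψ z.1)
      ((fderiv ℝ ψ q).comp (ContinuousLinearMap.fst ℝ (Eucl n) (Eucl n →L[ℝ] ℝ))) (q, p) :=
    HasFDerivAt.comp (q, p) (f := Prod.fst) (g := ψ) dψ hasFDerivAt_fst
  have d2 : HasFDerivAt (fun z : Phase n => z.2 + fderiv ℝ l z.1)
      (ContinuousLinearMap.snd ℝ (Eucl n) (Eucl n →L[ℝ] ℝ) + (fderiv ℝ (fderiv ℝ l) q).comp
        (ContinuousLinearMap.fst ℝ (Eucl n) (Eucl n →L[ℝ] ℝ))) (q, p) :=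
    hasFDerivAt_snd.add (HasFDerivAt.comp (q, p) (f := Prod.fst) (g := fderiv ℝ l) dl hasFDerivAt_fst)
  have d3 : HasFDerivAt (fun z : Phase n => fderiv ℝ χ (ψ z.1))
      ((fderiv ℝ (fderiv ℝ χ) (ψ q)).comp ((fderiv ℝ ψ q).comp
        (ContinuousLinearMap.fst ℝ (Eucl n) (Eucl n →L[ℝ] ℝ)))) (q, p) :=
    HasFDerivAt.comp (q, p) (f := fun z : Phase n => ψ z.1) (g := fderiv ℝ χ) dχ d1
  refine ⟨_, d1.prodMk (d2.clm_comp d3), fun v w => ?_⟩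
  have i1 : ∀ u, fderiv ℝ χ (ψ q) (fderiv ℝ ψ q u) = u := by
    have h1 : HasFDerivAt (fun y => χ (ψ y)) ((fderiv ℝ χ (ψ q)).comp (fderiv ℝ ψ q)) q :=
      HasFDerivAt.comp q (hχ.differentiableAt (by simp)).hasFDerivAt dψ
    have h2 : HasFDerivAt (fun y => χ (ψ y)) (ContinuousLinearMap.id ℝ (Eucl n)) q :=
      (hasFDerivAt_id q).congr_of_eventuallyEq hinv
    exact fun u => congrArg (fun L => L u) (h1.unique h2)
  have sl : ∀ u u', fderiv ℝ (fderiv ℝ l) q u u' = fderiv ℝ (fderiv ℝ l) q u' u :=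
    hl.isSymmSndFDerivAt (by simp only [minSmoothness_of_isRCLikeNormedField]; exact ENat.LEInfty.out)
  have sχ : ∀ u u', fderiv ℝ (fderiv ℝ χ) (ψ q) u u' = fderiv ℝ (fderiv ℝ χ) (ψ q) u' u :=
    hχ.isSymmSndFDerivAt (by simp only [minSmoothness_of_isRCLikeNormedField]; exact ENat.LEInfty.out)
  simp only [canonicalForm, ContinuousLinearMap.prod_apply, ContinuousLinearMap.comp_apply,
    add_apply, ContinuousLinearMap.compL_apply,
    ContinuousLinearMap.flip_apply, ContinuousLinearMap.coe_fst', ContinuousLinearMap.coe_snd', i1]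
  rw [sl v.1 w.1, sχ (fderiv ℝ ψ q v.1) (fderiv ℝ ψ q w.1)]
  ring

/-- The bracket of two Hamiltonians that are linear in the momenta. -/
theorem poissonCoord_linear {X Y : Eucl n → Eucl n} {c d : Eucl n → ℝ} {q : Eucl n}
    (hX : DifferentiableAt ℝ X q) (hY : DifferentiableAt ℝ Y q) (hc : DifferentiableAt ℝ c q)
    (hd : DifferentiableAt ℝ d q) (p : Eucl n →L[ℝ] ℝ) :
    poissonCoord (fun z => z.2 (X z.1) + c z.1) (fun z => z.2 (Y z.1) + d z.1) (q, p)
      = p (fderiv ℝ Y q (X q) - fderiv ℝ X q (Y q)) + fderiv ℝ d q (X q) - fderiv ℝ c q (Y q) := by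
  have key : ∀ {X : Eucl n → Eucl n} {c : Eucl n → ℝ}, DifferentiableAt ℝ X q →
      DifferentiableAt ℝ c q → ∀ v : Phase n,
      fderiv ℝ (fun z : Phase n => z.2 (X z.1) + c z.1) (q, p) v
        = v.2 (X q) + p (fderiv ℝ X q v.1) + fderiv ℝ c q v.1 := by
    intro X c hX hc v
    have d1 : HasFDerivAt (fun z : Phase n => X z.1) _ (q, p) :=
      HasFDerivAt.comp (q, p) (f := Prod.fst) (g := X) hX.hasFDerivAt hasFDerivAt_fst
    have d2 : HasFDerivAt (fun z : Phase n => c z.1) _ (q, p) :=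
      HasFDerivAt.comp (q, p) (f := Prod.fst) (g := c) hc.hasFDerivAt hasFDerivAt_fst
    have d3 : HasFDerivAt (fun z : Phase n => z.2)
        (ContinuousLinearMap.snd ℝ (Eucl n) (Eucl n →L[ℝ] ℝ)) (q, p) := hasFDerivAt_snd
    have d4 : HasFDerivAt (fun z : Phase n => z.2 (X z.1) + c z.1) _ (q, p) :=
      (d3.clm_apply d1).add d2
    rw [d4.fderiv]
    simp [add_comm]
  have hv : hamVec (fun z => z.2 (X z.1) + c z.1) (q, p)
      = (-X q, p.comp (fderiv ℝ X q) + fderiv ℝ c q) := by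
    refine eq_of_canonicalForm_eq fun w => ?_
    rw [canonicalForm_hamVec, key hX hc]
    simp [canonicalForm]
    ring
  rw [poissonCoord, hv, key hY hd]
  simp
  ring

/-- The bracket with a function of the coordinates only sees the derivatives in the momenta. -/
theorem poissonCoord_fst {h : Phase n → ℝ} {f : Eucl n → ℝ} {z : Phase n}
    (hf : DifferentiableAt ℝ f z.1) :
    poissonCoord h (fun z => f z.1) z
      = ∑ a, fderiv ℝ h z (dirP a) * fderiv ℝ f z.1 (EuclideanSpace.single a 1) := by
  have d2 : HasFDerivAt (fun z : Phase n => f z.1) _ z :=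
    HasFDerivAt.comp z (f := Prod.fst) (g := f) hf.hasFDerivAt hasFDerivAt_fst
  rw [poissonCoord_eq, d2.fderiv]
  simp [dirX, dirP]

section Derivation

variable {f g g' : Phase n → ℝ} {z : Phase n}

theorem poissonCoord_add (hg : DifferentiableAt ℝ g z) (hg' : DifferentiableAt ℝ g' z) :
    poissonCoord f (fun y => g y + g' y) z = poissonCoord f g z + poissonCoord f g' z := by
  unfold poissonCoord
  rw [fderiv_fun_add hg hg']
  simp [add_comm]

theorem poissonCoord_mul (hg : DifferentiableAt ℝ g z) (hg' : DifferentiableAt ℝ g' z) :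
    poissonCoord f (fun y => g y * g' y) z
      = g z * poissonCoord f g' z + poissonCoord f g z * g' z := by
  unfold poissonCoord
  rw [fderiv_fun_mul hg hg']
  simp
  ring

theorem poissonCoord_add_left (hg : DifferentiableAt ℝ g z) (hg' : DifferentiableAt ℝ g' z) :
    poissonCoord (fun y => g y + g' y) f z = poissonCoord g f z + poissonCoord g' f z := by
  simp only [poissonCoord_eq]
  rw [fderiv_fun_add hg hg',
    ← Finset.sum_add_distrib]
  refine Finset.sum_congr rfl fun a _ => ?_
  simp
  ring

theorem poissonCoord_smul_left (t : ℝ) (hg : DifferentiableAt ℝ g z) :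
    poissonCoord (fun y => t * g y) f z = t * poissonCoord g f z := by
  simp only [poissonCoord_eq]
  rw [(hg.hasFDerivAt.const_mul t : HasFDerivAt (fun y => t * g y) _ z).fderiv, Finset.mul_sum]
  refine Finset.sum_congr rfl fun a _ => ?_
  simp
  ring

theorem contDiffOn_poissonCoord {s : Set (Phase n)} (hs : IsOpen s) (hf : ContDiffOn ℝ ∞ f s)
    (hg : ContDiffOn ℝ ∞ g s) : ContDiffOn ℝ ∞ (poissonCoord f g) s := by
  have h : ∀ {f : Phase n → ℝ}, ContDiffOn ℝ ∞ f s → ∀ v,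
      ContDiffOn ℝ ∞ (fun z => fderiv ℝ f z v) s := fun hf v =>
    (hf.fderiv_of_isOpen hs le_rfl).clm_apply contDiffOn_const
  refine ContDiffOn.congr ?_ fun z _ => poissonCoord_eq f g z
  exact ContDiffOn.sum fun a _ => ((h hf _).mul (h hg _)).sub ((h hf _).mul (h hg _))

end Derivation

end PhaseCalculus

/-! ### Frames, connection forms and isomorphisms of line bundles -/

section FrameCalculus

variable {n : ℕ} {V : Type u} [TopologicalSpace V] [ChartedSpace (Eucl n) V]

theorem diff_comp_real {f : V → ℝ} {x : V} (hf : MDifferentiableAt (𝓡 n) 𝓘(ℝ, ℝ) f x)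
    {φ : ℝ → ℝ} {φ' : ℝ} (hφ : HasDerivAt φ φ' (f x)) :
    diff n (fun y => φ (f y)) x = φ' • diff n f x := by
  have h : HasMFDerivAt 𝓘(ℝ, ℝ) 𝓘(ℝ, ℝ) φ (f x) (ContinuousLinearMap.toSpanSingleton ℝ φ') :=
    hφ.hasFDerivAt.hasMFDerivAt
  have := (h.comp x hf.hasMFDerivAt).mfderiv
  refine this.trans (ContinuousLinearMap.ext fun v => ?_)
  exact mul_comm (diff n f x v : ℝ) φ'

theorem diff_congr {f g : V → ℝ} {x : V} (h : f =ᶠ[𝓝 x] g) : diff n f x = diff n g x :=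
  h.mfderiv_eq

theorem SmoothOn.mdifferentiableAt {f : V → ℝ} {s : Set V} (hf : SmoothOn n f s) (hs : IsOpen s)
    {x : V} (hx : x ∈ s) : MDifferentiableAt (𝓡 n) 𝓘(ℝ, ℝ) f x :=
  (hf.contMDiffAt (hs.mem_nhds hx)).mdifferentiableAt (by simp)

variable {L : LineBundle n V}

theorem triv_div_smul (x : V) {y : V} (hy : y ∈ (trivializationAt ℝ L.fiber x).baseSet)
    (v : L.fiber y) {w : L.fiber y} (hw : w ≠ 0) :
    ((trivializationAt ℝ L.fiber x ⟨y, v⟩).2 / (trivializationAt ℝ L.fiber x ⟨y, w⟩).2) • w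
      = v := by
  apply ((trivializationAt ℝ L.fiber x).linearEquivAt ℝ y hy).injective
  rw [map_smul]
  exact div_mul_cancel₀ _ (triv_ne_zero x hy hw)

namespace Frame

variable (e e' : Frame L)

/-- The coordinate of a vector of the line bundle with respect to a frame. It is computed in the
trivialization at the base point of the vector, and is `0` outside the domain of the frame if `sec`
vanishes there. -/
def coord (v : TotalSpace ℝ L.fiber) : ℝ :=
  (trivializationAt ℝ L.fiber v.1 v).2 / (trivializationAt ℝ L.fiber v.1 ⟨v.1, e.sec v.1⟩).2

/-- The quotient `e' / e` of two frames. -/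
def quot (y : V) : ℝ := e.coord ⟨y, e'.sec y⟩

variable {e e'}

theorem coord_smul {y : V} (hy : y ∈ e.dom) (v : L.fiber y) : e.coord ⟨y, v⟩ • e.sec y = v :=
  triv_div_smul y (FiberBundle.mem_baseSet_trivializationAt' y) v (e.ne_zero y hy)

theorem coord_eq {y : V} (hy : y ∈ e.dom) {v : L.fiber y} {r : ℝ} (h : v = r • e.sec y) :
    e.coord ⟨y, v⟩ = r :=
  smul_left_injective ℝ (e.ne_zero y hy) ((coord_smul hy v).trans h)

theorem quot_smul {y : V} (hy : y ∈ e.dom) : e.quot e' y • e.sec y = e'.sec y :=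
  coord_smul hy _

theorem quot_ne_zero {y : V} (hy : y ∈ e.dom) (hy' : y ∈ e'.dom) : e.quot e' y ≠ 0 := by
  intro h
  have := quot_smul (e' := e') hy
  rw [h, zero_smul] at this
  exact e'.ne_zero y hy' this.symm

/-- The fibre of a line bundle as the real line, by means of a frame. -/
def coordEquiv {y : V} (hy : y ∈ e.dom) : L.fiber y ≃ₗ[ℝ] ℝ where
  toFun v := e.coord ⟨y, v⟩
  invFun r := r • e.sec y
  map_add' v w := coord_eq hy (by rw [add_smul, coord_smul hy, coord_smul hy])
  map_smul' r v := coord_eq hy (by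
    rw [RingHom.id_apply, smul_eq_mul, mul_smul, coord_smul hy])
  left_inv v := coord_smul hy v
  right_inv r := coord_eq hy rfl

theorem contMDiffAt_coord {v : TotalSpace ℝ L.fiber} (hv : v.1 ∈ e.dom) :
    ContMDiffAt ((𝓡 n).prod 𝓘(ℝ, ℝ)) 𝓘(ℝ, ℝ) ∞ e.coord v := by
  have hp : ContMDiffAt ((𝓡 n).prod 𝓘(ℝ, ℝ)) (𝓡 n) ∞
      (fun w : TotalSpace ℝ L.fiber => w.1) v := contMDiffAt_proj L.fiber
  have h1 : ContMDiffAt ((𝓡 n).prod 𝓘(ℝ, ℝ)) 𝓘(ℝ, ℝ) ∞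
      (fun w => (trivializationAt ℝ L.fiber v.1 w).2) v :=
    (contMDiffAt_totalSpace.1 contMDiffAt_id).2
  have h2 : ContMDiffAt ((𝓡 n).prod 𝓘(ℝ, ℝ)) 𝓘(ℝ, ℝ) ∞
      (fun w : TotalSpace ℝ L.fiber => (trivializationAt ℝ L.fiber v.1 ⟨w.1, e.sec w.1⟩).2) v :=
    ContMDiffAt.comp (g := fun y => (trivializationAt ℝ L.fiber v.1 ⟨y, e.sec y⟩).2) v
      (contMDiffAt_triv e hv) hp
  refine (h1.div₀ h2 (triv_ne_zero _ (FiberBundle.mem_baseSet_trivializationAt' _)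
    (e.ne_zero _ hv))).congr_of_eventuallyEq ?_
  filter_upwards [hp.continuousAt.preimage_mem_nhds (e.dom.isOpen.mem_nhds hv),
    hp.continuousAt.preimage_mem_nhds ((trivializationAt ℝ L.fiber v.1).open_baseSet.mem_nhds
      (FiberBundle.mem_baseSet_trivializationAt' v.1))] with w hw hw'
  exact coord_eq hw (triv_div_smul v.1 hw' _ (e.ne_zero _ hw)).symm

theorem contMDiffOn_quot : SmoothOn n (e.quot e') (e.dom ∩ e'.dom) := fun x hx =>
  ((contMDiffAt_coord (v := ⟨x, e'.sec x⟩) hx.1).comp x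
    (e'.smooth.contMDiffAt (e'.dom.isOpen.mem_nhds hx.2))).contMDiffWithinAt

/-- The logarithm of the absolute value of the quotient of two frames. -/
def logQuot (e e' : Frame L) (y : V) : ℝ := Real.log (e.quot e' y)

theorem contMDiffOn_logQuot : SmoothOn n (e.logQuot e') (e.dom ∩ e'.dom) := fun x hx =>
  ((Real.contDiffAt_log.2 (quot_ne_zero hx.1 hx.2)).contMDiffAt.comp x
    (contMDiffOn_quot.contMDiffAt ((e.dom.isOpen.inter e'.dom.isOpen).mem_nhds hx))
    ).contMDiffWithinAt

/-- The frame `exp(f) e` over an open subset of the domain of `e`. -/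
def rescale (e : Frame L) (f : V → ℝ) (s : TopologicalSpace.Opens V) (hs : s ≤ e.dom)
    (hf : SmoothOn n f s) : Frame L where
  dom := s
  sec y := Real.exp (f y) • e.sec y
  smooth := ContMDiffOn.smul_section (V := L.fiber) (f := fun y => Real.exp (f y))
    (Real.contDiff_exp.contMDiff.comp_contMDiffOn hf) (e.smooth.mono hs)
  ne_zero y hy := smul_ne_zero (Real.exp_ne_zero _) (e.ne_zero y (hs hy))

end Frame

namespace ConnAt

variable {x : V} {e e' : Frame L}

/-- The gauge transformation of the connection form, in which the sign of `e' / e` is irrelevant. -/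
theorem form_eq_add_logQuot (D : ConnAt L x) (h : x ∈ e.dom) (h' : x ∈ e'.dom) :
    D.form e' h' = D.form e h + diff n (e.logQuot e') x := by
  rw [D.gauge e e' h h' (e.quot e') ?_]
  · congr 1
    exact (diff_comp_real (Frame.contMDiffOn_quot.mdifferentiableAt
      (e.dom.isOpen.inter e'.dom.isOpen) ⟨h, h'⟩)
      (Real.hasDerivAt_log (Frame.quot_ne_zero h h'))).symm
  · filter_upwards [e.dom.isOpen.mem_nhds h] with y hy using (Frame.quot_smul hy).symm

theorem form_eq_add_of_exp (D : ConnAt L x) (h : x ∈ e.dom) (h' : x ∈ e'.dom) {f : V → ℝ}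
    (hf : MDifferentiableAt (𝓡 n) 𝓘(ℝ, ℝ) f x)
    (he : ∀ᶠ y in 𝓝 x, e'.sec y = Real.exp (f y) • e.sec y) :
    D.form e' h' = D.form e h + diff n f x := by
  rw [D.gauge e e' h h' _ he, diff_comp_real hf (Real.hasDerivAt_exp _), smul_smul,
    inv_mul_cancel₀ (Real.exp_ne_zero _), one_smul]

theorem ext_form {D D' : ConnAt L x} (h : x ∈ e.dom) (hD : D.form e h = D'.form e h) : D = D' := by
  ext e' h'
  rw [D.form_eq_add_logQuot h h', D'.form_eq_add_logQuot h h', hD]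

theorem ofForm_form (h h' : x ∈ e.dom) (ξ : Cotangent n x) : (ofForm e h ξ).form e h' = ξ := by
  have h1 : ratio x e.sec e.sec =ᶠ[𝓝 x] fun _ => 1 := by
    filter_upwards [e.dom.isOpen.mem_nhds h, (trivializationAt ℝ L.fiber x).open_baseSet.mem_nhds
      (FiberBundle.mem_baseSet_trivializationAt' x)] with y hy hyb
    exact div_self (triv_ne_zero x hyb (e.ne_zero y hy))
  change ξ + _ • diff n (ratio x e.sec e.sec) x = ξ
  rw [diff_congr h1]
  have : diff n (fun _ : V => (1 : ℝ)) x = 0 := mfderiv_const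
  rw [this, smul_zero, add_zero]

theorem existsUnique_vadd [IsManifold (𝓡 n) ∞ V] (D D' : ConnAt L x) :
    ∃! ξ : Cotangent n x, ξ +ᵥ D = D' := by
  have h := mem_stdFrame L x
  have hf : ∀ ξ : Cotangent n x, (ξ +ᵥ D).form (stdFrame L x) h = ξ + D.form (stdFrame L x) h :=
    fun _ => rfl
  refine ⟨D'.form (stdFrame L x) h - D.form (stdFrame L x) h, ext_form h ?_, fun ξ hξ => ?_⟩
  · rw [hf, sub_add_cancel]
  · rw [← hξ, hf, add_sub_cancel_right]

end ConnAt

/-- A line bundle with positive transition functions is trivial: local frames that differ by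
positive factors are glued with a partition of unity. -/
theorem ExpLineBundle.exists_global_frame [IsManifold (𝓡 n) ∞ V] [T2Space V]
    [SecondCountableTopology V] (L : ExpLineBundle n V) :
    ∃ e : Frame L.toLineBundle, e.dom = ⊤ := by
  have : LocallyCompactSpace V := ChartedSpace.locallyCompactSpace (Eucl n) V
  obtain ⟨S, hcov, hS⟩ := L.exists_frames
  -- the vectors that are positive with respect to all the given frames form a convex set
  let t : ∀ x, Set (L.fiber x) := fun x =>
    {v | ∀ e ∈ S, x ∈ e.dom → ∃ r : ℝ, 0 < r ∧ v = r • e.sec x}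
  have ht : ∀ x, Convex ℝ (t x) := by
    intro x v hv w hw a b ha hb hab e he hx
    obtain ⟨r, hr, rfl⟩ := hv e he hx
    obtain ⟨r', hr', rfl⟩ := hw e he hx
    refine ⟨a * r + b * r', ?_, by rw [add_smul, mul_smul, mul_smul]⟩
    rcases ha.eq_or_lt with rfl | ha
    · rw [zero_add] at hab
      subst hab
      simpa using hr'
    · have := mul_pos ha hr
      have := mul_nonneg hb hr'.le
      linarith
  obtain ⟨s, hs⟩ := exists_contMDiffSection_forall_mem_convex_of_local (n := (⊤ : ℕ∞)) (𝓡 n)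
    (F_fiber := ℝ) L.fiber t ht fun x₀ => by
      obtain ⟨e, he, hx⟩ := hcov x₀
      refine ⟨e.dom, e.dom.isOpen.mem_nhds hx, e.sec, e.smooth, fun y hy e' he' hy' => ?_⟩
      obtain ⟨r, hr⟩ := hS e he e' he' y hy hy'
      refine ⟨Real.exp (-r), Real.exp_pos _, ?_⟩
      rw [hr, smul_smul, ← Real.exp_add, neg_add_cancel, Real.exp_zero, one_smul]
  refine ⟨⟨⊤, s, s.contMDiff.contMDiffOn, fun x _ => ?_⟩, rfl⟩
  obtain ⟨e, he, hx⟩ := hcov x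
  obtain ⟨r, hr, h⟩ := hs x e he hx
  rw [h]
  exact smul_ne_zero hr.ne' (e.ne_zero x hx)

end FrameCalculus

section LineIsos

variable {n : ℕ} {V : Type u} [TopologicalSpace V] [ChartedSpace (Eucl n) V]
  {L L' : LineBundle n V} {ι : Type*}

/-- A fibrewise linear map that takes local frames to local frames is smooth. -/
theorem contMDiff_of_map_frames (e : ι → Frame L) (e' : ι → Frame L')
    (hcov : ∀ x, ∃ i, x ∈ (e i).dom ∧ x ∈ (e' i).dom) (Φ : ∀ x, L.fiber x →ₗ[ℝ] L'.fiber x)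
    (hΦ : ∀ i, ∀ x ∈ (e i).dom, x ∈ (e' i).dom → Φ x ((e i).sec x) = (e' i).sec x) :
    ContMDiff ((𝓡 n).prod 𝓘(ℝ, ℝ)) ((𝓡 n).prod 𝓘(ℝ, ℝ)) ∞
      (fun v : TotalSpace ℝ L.fiber => (⟨v.1, Φ v.1 v.2⟩ : TotalSpace ℝ L'.fiber)) := by
  intro v
  obtain ⟨i, hi, hi'⟩ := hcov v.1
  have hp : ContMDiffAt ((𝓡 n).prod 𝓘(ℝ, ℝ)) (𝓡 n) ∞
      (fun w : TotalSpace ℝ L.fiber => w.1) v := contMDiffAt_proj L.fiber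
  refine contMDiffAt_totalSpace.2 ⟨hp, ?_⟩
  have h2 : ContMDiffAt ((𝓡 n).prod 𝓘(ℝ, ℝ)) 𝓘(ℝ, ℝ) ∞ (fun w : TotalSpace ℝ L.fiber =>
      (trivializationAt ℝ L'.fiber v.1 ⟨w.1, (e' i).sec w.1⟩).2) v :=
    ContMDiffAt.comp (g := fun y => (trivializationAt ℝ L'.fiber v.1 ⟨y, (e' i).sec y⟩).2) v
      (contMDiffAt_triv (e' i) hi') hp
  refine ((Frame.contMDiffAt_coord hi).mul h2).congr_of_eventuallyEq ?_
  filter_upwards [hp.continuousAt.preimage_mem_nhds ((e i).dom.isOpen.mem_nhds hi),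
    hp.continuousAt.preimage_mem_nhds ((e' i).dom.isOpen.mem_nhds hi'),
    hp.continuousAt.preimage_mem_nhds ((trivializationAt ℝ L'.fiber v.1).open_baseSet.mem_nhds
      (FiberBundle.mem_baseSet_trivializationAt' v.1))] with w hw hw' hwb
  have : Φ w.1 w.2 = (e i).coord w • (e' i).sec w.1 := by
    conv_lhs => rw [← Frame.coord_smul (e := e i) hw w.2]
    rw [map_smul, hΦ i _ hw hw']
  change (trivializationAt ℝ L'.fiber v.1 ⟨w.1, Φ w.1 w.2⟩).2 = _
  rw [this, triv_smul v.1 hwb]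
  rfl

/-- Two families of frames with the same transition functions define an isomorphism of the line
bundles. -/
theorem LineIso.exists_of_frames (e : ι → Frame L) (e' : ι → Frame L')
    (hdom : ∀ i, (e i).dom = (e' i).dom) (hcov : ∀ x, ∃ i, x ∈ (e i).dom)
    (h : ∀ i j, ∀ x ∈ (e i).dom, x ∈ (e j).dom → (e i).quot (e j) x = (e' i).quot (e' j) x) :
    ∃ Φ : LineIso L L', ∀ i, ∀ x ∈ (e i).dom, Φ.toEquiv x ((e i).sec x) = (e' i).sec x := by
  choose k hk using hcov
  have hk' : ∀ x, x ∈ (e' (k x)).dom := fun x => hdom (k x) ▸ hk x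
  let Φ : ∀ x, L.fiber x ≃ₗ[ℝ] L'.fiber x := fun x =>
    (Frame.coordEquiv (hk x)).trans (Frame.coordEquiv (hk' x)).symm
  have hΦ : ∀ i, ∀ x ∈ (e i).dom, Φ x ((e i).sec x) = (e' i).sec x := by
    intro i x hx
    change (e (k x)).quot (e i) x • (e' (k x)).sec x = _
    rw [h _ _ x (hk x) hx, Frame.quot_smul (hk' x)]
  refine ⟨⟨Φ, ?_, ?_⟩, hΦ⟩
  · exact contMDiff_of_map_frames e e' (fun x => ⟨k x, hk x, hk' x⟩) (fun x => (Φ x).toLinearMap)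
      fun i x hx _ => hΦ i x hx
  · exact contMDiff_of_map_frames e' e (fun x => ⟨k x, hk' x, hk x⟩)
      (fun x => (Φ x).symm.toLinearMap)
      fun i x _ hx => (LinearEquiv.symm_apply_eq _).2 (hΦ i x hx).symm

end LineIsos

/-! ### Smooth functions and Poisson brackets in Darboux charts -/

section DarbouxCharts

variable {n : ℕ} {V : Type u} [TopologicalSpace V] [ChartedSpace (Eucl n) V]
  {φ φ' : OpenPartialHomeomorph V (Eucl n)} {L : LineBundle n V} {e e' : Frame L}

theorem isOpen_darbouxTarget (φ : OpenPartialHomeomorph V (Eucl n)) (e : Frame L) :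
    IsOpen (darbouxTarget φ e) :=
  (φ.isOpen_inter_preimage_symm e.dom.isOpen).preimage continuous_fst

/-- Two points of `R` agree if they lie over the same point and have the same connection form in
one frame. -/
theorem conn_ext {r s : Conn L} (h : r.1 = s.1) (hr : r.1 ∈ e.dom) (hs : s.1 ∈ e.dom)
    (hf : ∀ v : Eucl n, r.2.form e hr v = s.2.form e hs v) : r = s := by
  obtain ⟨x, D⟩ := r
  obtain ⟨y, D'⟩ := s
  obtain rfl : x = y := h
  exact congrArg (Sigma.mk x) (ConnAt.ext_form hr (ContinuousLinearMap.ext hf))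

theorem darbouxCoord_mem {r : Conn L} (hr : r.1 ∈ φ.source) (h : r.1 ∈ e.dom) :
    darbouxCoord φ e r h ∈ darbouxTarget φ e :=
  ⟨φ.map_source hr, by
    change φ.symm (φ r.1) ∈ e.dom
    rwa [φ.left_inv hr]⟩

variable [IsManifold (𝓡 n) ∞ V]

theorem contMDiffAt_of_mem_atlas (hφ : φ ∈ atlas (Eucl n) V) {x : V} (hx : x ∈ φ.source) :
    ContMDiffAt (𝓡 n) (𝓡 n) ∞ φ x :=
  contMDiffAt_of_mem_maximalAtlas (IsManifold.subset_maximalAtlas hφ) hx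

theorem contMDiffAt_symm_of_mem_atlas (hφ : φ ∈ atlas (Eucl n) V) {q : Eucl n}
    (hq : q ∈ φ.target) : ContMDiffAt (𝓡 n) (𝓡 n) ∞ φ.symm q :=
  contMDiffAt_symm_of_mem_maximalAtlas (IsManifold.subset_maximalAtlas hφ) hq

theorem contDiffAt_comp_chart_symm (hφ : φ ∈ atlas (Eucl n) V) {E : Type*} [NormedAddCommGroup E]
    [NormedSpace ℝ E] {f : V → E} {x : V} (hx : x ∈ φ.source)
    (hf : ContMDiffAt (𝓡 n) 𝓘(ℝ, E) ∞ f x) :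
    ContDiffAt ℝ ∞ (fun q => f (φ.symm q)) (φ x) := by
  rw [← contMDiffAt_iff_contDiffAt]
  refine ContMDiffAt.comp (g := f) (φ x) ?_ (contMDiffAt_symm_of_mem_atlas hφ (φ.map_source hx))
  rwa [φ.left_inv hx]

/-- The chain rule for the coordinate representation of a map. -/
theorem mfderiv_eq_fderiv_comp (hφ : φ ∈ atlas (Eucl n) V) {E : Type*} [NormedAddCommGroup E]
    [NormedSpace ℝ E] {f : V → E} {x : V} (hx : x ∈ φ.source)
    (hf : ContMDiffAt (𝓡 n) 𝓘(ℝ, E) ∞ f x) (v : TangentSpace (𝓡 n) x) :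
    mfderiv (𝓡 n) 𝓘(ℝ, E) f x v
      = fderiv ℝ (fun q => f (φ.symm q)) (φ x) (mfderiv (𝓡 n) (𝓡 n) φ x v) := by
  have h1 : MDifferentiableAt (𝓡 n) (𝓡 n) φ x :=
    (contMDiffAt_of_mem_atlas hφ hx).mdifferentiableAt (by simp)
  have h2 : MDifferentiableAt (𝓡 n) 𝓘(ℝ, E) (fun q => f (φ.symm q)) (φ x) :=
    ((contDiffAt_comp_chart_symm hφ hx hf).differentiableAt (by simp)).mdifferentiableAt
  have h3 : (fun q => f (φ.symm q)) ∘ φ =ᶠ[𝓝 x] f := by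
    filter_upwards [φ.open_source.mem_nhds hx] with y hy
    simp only [Function.comp_apply, φ.left_inv hy]
  rw [← h3.mfderiv_eq, mfderiv_comp x h2 h1, mfderiv_eq_fderiv]
  rfl

theorem mfderiv_chart_symm_comp (hφ : φ ∈ atlas (Eucl n) V) {x : V} (hx : x ∈ φ.source)
    (v : TangentSpace (𝓡 n) x) :
    mfderiv (𝓡 n) (𝓡 n) φ.symm (φ x) (mfderiv (𝓡 n) (𝓡 n) φ x v) = v :=
  congrArg (fun l => l v) ((mdifferentiable_of_mem_atlas (I := 𝓡 n) hφ).symm_comp_deriv hx)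

theorem mfderiv_chart_comp_symm (hφ : φ ∈ atlas (Eucl n) V) {x : V} (hx : x ∈ φ.source)
    (v : Eucl n) :
    mfderiv (𝓡 n) (𝓡 n) φ x (mfderiv (𝓡 n) (𝓡 n) φ.symm (φ x) v) = v := by
  have := congrArg (fun l => l v) ((mdifferentiable_of_mem_atlas (I := 𝓡 n) hφ).comp_symm_deriv
    (φ.map_source hx))
  rw [φ.left_inv hx] at this
  exact this

theorem darboux_of_mem {z : Phase n} (h : φ.symm z.1 ∈ e.dom) : darboux φ e z =
    ⟨φ.symm z.1, ConnAt.ofForm e h (z.2.comp (mfderiv (𝓡 n) (𝓡 n) φ (φ.symm z.1)))⟩ := by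
  unfold darboux
  rw [dif_pos h]

theorem darboux_form {z : Phase n} (h : (darboux φ e z).1 ∈ e.dom) (v : Eucl n) :
    (darboux φ e z).2.form e h v = z.2 (mfderiv (𝓡 n) (𝓡 n) φ (φ.symm z.1) v) := by
  have key : ∀ {r s : Conn L} (_ : r = s) (hr : r.1 ∈ e.dom) (hs : s.1 ∈ e.dom),
      ∀ v : Eucl n, r.2.form e hr v = s.2.form e hs v := by
    rintro r _ rfl hr hs v
    rfl
  exact (key (darboux_of_mem h) h h v).trans
    (congrArg (fun l : Eucl n →L[ℝ] ℝ => l v) (ConnAt.ofForm_form h h _))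

theorem darboux_darbouxCoord (hφ : φ ∈ atlas (Eucl n) V) {r : Conn L} (hr : r.1 ∈ φ.source)
    (h : r.1 ∈ e.dom) : darboux φ e (darbouxCoord φ e r h) = r := by
  have h1 : (darboux φ e (darbouxCoord φ e r h)).1 = r.1 := φ.left_inv hr
  refine conn_ext (e := e) h1 (h1 ▸ h) h fun v => ?_
  refine (darboux_form _ v).trans ?_
  change r.2.form e h (mfderiv (𝓡 n) (𝓡 n) φ.symm (φ r.1)
    (mfderiv (𝓡 n) (𝓡 n) φ (φ.symm (φ r.1)) v)) = _
  rw [φ.left_inv hr]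
  exact congrArg (r.2.form e h) (mfderiv_chart_symm_comp hφ hr v)

theorem darbouxCoord_darboux (hφ : φ ∈ atlas (Eucl n) V) {z : Phase n}
    (hz : z ∈ darbouxTarget φ e) : darbouxCoord φ e (darboux φ e z) hz.2 = z := by
  have hs : φ.symm z.1 ∈ φ.source := φ.map_target hz.1
  refine Prod.ext (φ.right_inv hz.1) (ContinuousLinearMap.ext fun v => ?_)
  change (darboux φ e z).2.form e hz.2 (mfderiv (𝓡 n) (𝓡 n) φ.symm (φ (φ.symm z.1)) v) = _
  exact (darboux_form _ _).trans (congrArg z.2 (mfderiv_chart_comp_symm hφ hs v))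

theorem eventually_darboux {r : Conn L} (hr : r.1 ∈ φ.source) (h : r.1 ∈ e.dom) {W : Set V}
    (hW : W ∈ 𝓝 r.1) : ∀ᶠ z in 𝓝 (darbouxCoord φ e r h), (darboux φ e z).1 ∈ W := by
  have : ContinuousAt (fun z : Phase n => φ.symm z.1) (darbouxCoord φ e r h) :=
    ContinuousAt.comp (f := Prod.fst) (g := φ.symm)
      (φ.continuousAt_symm (φ.map_source hr)) continuousAt_fst
  refine this.preimage_mem_nhds ?_
  change W ∈ 𝓝 (φ.symm (φ r.1))
  rwa [φ.left_inv hr]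

/-- The transition maps between Darboux charts are smooth and symplectic. -/
theorem exists_darboux_transition (hφ : φ ∈ atlas (Eucl n) V) (hφ' : φ' ∈ atlas (Eucl n) V)
    {r : Conn L} (hr : r.1 ∈ φ.source) (hr' : r.1 ∈ φ'.source) (h : r.1 ∈ e.dom)
    (h' : r.1 ∈ e'.dom) :
    ∃ (T : Phase n → Phase n) (T' : Phase n →L[ℝ] Phase n),
      ContDiffAt ℝ ∞ T (darbouxCoord φ e r h) ∧
      T (darbouxCoord φ e r h) = darbouxCoord φ' e' r h' ∧
      (∀ᶠ z in 𝓝 (darbouxCoord φ e r h), darboux φ e z = darboux φ' e' (T z)) ∧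
      HasFDerivAt T T' (darbouxCoord φ e r h) ∧
      ∀ v w, canonicalForm (T' v) (T' w) = canonicalForm v w := by
  -- the coordinates change by `ψ`, with inverse `χ`, and the connection form by `d(log(e' / e))`
  let ψ : Eucl n → Eucl n := fun q => φ' (φ.symm q)
  let χ : Eucl n → Eucl n := fun q => φ (φ'.symm q)
  let l : Eucl n → ℝ := fun q => e.logQuot e' (φ.symm q)
  have hψx : ψ (φ r.1) = φ' r.1 := congrArg φ' (φ.left_inv hr)
  have sψ : ContDiffAt ℝ ∞ ψ (φ r.1) :=
    contDiffAt_comp_chart_symm hφ hr (contMDiffAt_of_mem_atlas hφ' hr')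
  have sχ : ContDiffAt ℝ ∞ χ (ψ (φ r.1)) := by
    rw [hψx]
    exact contDiffAt_comp_chart_symm hφ' hr' (contMDiffAt_of_mem_atlas hφ hr)
  have slog : ∀ y ∈ e.dom, y ∈ e'.dom → ContMDiffAt (𝓡 n) 𝓘(ℝ, ℝ) ∞ (e.logQuot e') y :=
    fun y hy hy' => Frame.contMDiffOn_logQuot.contMDiffAt
      ((e.dom.isOpen.inter e'.dom.isOpen).mem_nhds ⟨hy, hy'⟩)
  have sl : ContDiffAt ℝ ∞ l (φ r.1) := contDiffAt_comp_chart_symm hφ hr (slog _ h h')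
  have hinv : ∀ᶠ q in 𝓝 (φ r.1), χ (ψ q) = q := by
    have h1 : ∀ᶠ q in 𝓝 (φ r.1), φ.symm q ∈ φ'.source := by
      refine (φ.continuousAt_symm (φ.map_source hr)).preimage_mem_nhds ?_
      rw [φ.left_inv hr]
      exact φ'.open_source.mem_nhds hr'
    filter_upwards [h1, φ.open_target.mem_nhds (φ.map_source hr)] with q hq hq'
    change φ (φ'.symm (φ' (φ.symm q))) = q
    rw [φ'.left_inv hq, φ.right_inv hq']
  let T : Phase n → Phase n :=
    fun z => (ψ z.1, (z.2 + fderiv ℝ l z.1).comp (fderiv ℝ χ (ψ z.1)))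
  obtain ⟨T', hT', hs⟩ := exists_symplectic_fderiv sψ sχ sl hinv (darbouxCoord φ e r h).2
  have hTs : ContDiffAt ℝ ∞ T (darbouxCoord φ e r h) := by
    have f1 : ContDiffAt ℝ ∞ (fun z : Phase n => z.1) (darbouxCoord φ e r h) := contDiffAt_fst
    have f2 : ContDiffAt ℝ ∞ (fun z : Phase n => z.2) (darbouxCoord φ e r h) := contDiffAt_snd
    have g1 : ContDiffAt ℝ ∞ (fun z : Phase n => ψ z.1) (darbouxCoord φ e r h) :=
      ContDiffAt.comp (g := ψ) _ sψ f1
    refine g1.prodMk (ContDiffAt.clm_comp (f2.add ?_) ?_)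
    · exact ContDiffAt.comp (g := fderiv ℝ l) _ (sl.fderiv_right (m := ∞) le_rfl) f1
    · exact ContDiffAt.comp (g := fderiv ℝ χ) _ (sχ.fderiv_right (m := ∞) le_rfl) g1
  have hev : ∀ᶠ z in 𝓝 (darbouxCoord φ e r h), darboux φ e z = darboux φ' e' (T z) := by
    filter_upwards [(isOpen_darbouxTarget φ e).mem_nhds (darbouxCoord_mem hr h),
      eventually_darboux (φ := φ) hr h (φ'.open_source.mem_nhds hr'),
      eventually_darboux (φ := φ) hr h (e'.dom.isOpen.mem_nhds h')] with z hz hz1 hz2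
    have hs : φ.symm z.1 ∈ φ.source := φ.map_target hz.1
    have e1 : φ'.symm (ψ z.1) = φ.symm z.1 := φ'.left_inv hz1
    have e2 : φ (φ.symm z.1) = z.1 := φ.right_inv hz.1
    have hT2 : (darboux φ' e' (T z)).1 ∈ e'.dom := by
      change φ'.symm (ψ z.1) ∈ e'.dom
      rwa [e1]
    refine conn_ext (e := e') e1.symm hz2 hT2 fun v => ?_
    refine Eq.trans ?_ (darboux_form hT2 v).symm
    refine (congrArg (fun l : Eucl n →L[ℝ] ℝ => l v)
      (ConnAt.form_eq_add_logQuot _ hz.2 hz2)).trans ?_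
    change (darboux φ e z).2.form e hz.2 v + diff n (e.logQuot e') (φ.symm z.1) v
      = (z.2 + fderiv ℝ l z.1) (fderiv ℝ χ (ψ z.1)
        (mfderiv (𝓡 n) (𝓡 n) φ' (φ'.symm (ψ z.1)) v))
    have e3 : fderiv ℝ χ (ψ z.1) (mfderiv (𝓡 n) (𝓡 n) φ' (φ'.symm (ψ z.1)) v)
        = mfderiv (𝓡 n) (𝓡 n) φ (φ.symm z.1) v := by
      rw [e1]
      exact (mfderiv_eq_fderiv_comp hφ' hz1 (contMDiffAt_of_mem_atlas hφ hs) v).symm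
    have e4 := mfderiv_eq_fderiv_comp hφ hs (slog _ hz.2 hz2) v
    rw [e2] at e4
    rw [e3]
    exact congrArg₂ (fun a b : ℝ => a + b) (darboux_form hz.2 v) e4
  refine ⟨T, T', hTs, ?_, hev, hT', hs⟩
  have h1 := hev.self_of_nhds
  rw [darboux_darbouxCoord hφ hr] at h1
  have h2 : T (darbouxCoord φ e r h) ∈ darbouxTarget φ' e' := by
    constructor
    · change ψ (φ r.1) ∈ φ'.target
      rw [hψx]
      exact φ'.map_source hr'
    · change φ'.symm (ψ (φ r.1)) ∈ e'.dom
      rwa [hψx, φ'.left_inv hr']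
  have h3 := darbouxCoord_darboux hφ' h2
  rw [← h3]
  congr 1
  exact h1.symm

/-- The Poisson bracket may be computed in any Darboux chart. -/
theorem poisson_eq (hφ : φ ∈ atlas (Eucl n) V) {f g : Conn L → ℝ} {r : Conn L}
    (hr : r.1 ∈ φ.source) (h : r.1 ∈ e.dom)
    (hf : DifferentiableAt ℝ (fun z => f (darboux φ e z)) (darbouxCoord φ e r h))
    (hg : DifferentiableAt ℝ (fun z => g (darboux φ e z)) (darbouxCoord φ e r h)) :
    poisson f g r = poissonCoord (fun z => f (darboux φ e z)) (fun z => g (darboux φ e z))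
      (darbouxCoord φ e r h) := by
  obtain ⟨T, T', -, hT, hev, hT', hs⟩ := exists_darboux_transition
    (chart_mem_atlas (Eucl n) r.1) hφ (mem_chart_source (Eucl n) r.1) hr (mem_stdFrame L r.1) h
  rw [← hT] at hf hg ⊢
  rw [← poissonCoord_comp hT' hs hf hg]
  exact poissonCoord_congr (hev.mono fun z hz => congrArg f hz)
    (hev.mono fun z hz => congrArg g hz)

theorem SmoothFun.contDiffAt {f : Conn L → ℝ} (hf : SmoothFun f) (hφ : φ ∈ atlas (Eucl n) V)
    {r : Conn L} (hr : r.1 ∈ φ.source) (h : r.1 ∈ e.dom) :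
    ContDiffAt ℝ ∞ (fun z => f (darboux φ e z)) (darbouxCoord φ e r h) :=
  (hf φ hφ e).contDiffAt ((isOpen_darbouxTarget φ e).mem_nhds (darbouxCoord_mem hr h))

theorem SmoothFun.differentiableAt {f : Conn L → ℝ} (hf : SmoothFun f) (r : Conn L) :
    DifferentiableAt ℝ (fun z => f (darboux (chartAt (Eucl n) r.1) (stdFrame L r.1) z))
      (darbouxCoord (chartAt (Eucl n) r.1) (stdFrame L r.1) r (mem_stdFrame L r.1)) :=
  (hf.contDiffAt (chart_mem_atlas _ _) (mem_chart_source _ _) _).differentiableAt (by simp)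

/-- Smoothness of a function on `R` may be checked in one Darboux chart at each point. -/
theorem smoothFun_of_exists {f : Conn L → ℝ}
    (hf : ∀ r : Conn L, ∃ φ ∈ atlas (Eucl n) V, ∃ (e : Frame L) (h : r.1 ∈ e.dom),
      r.1 ∈ φ.source ∧ ContDiffAt ℝ ∞ (fun z => f (darboux φ e z)) (darbouxCoord φ e r h)) :
    SmoothFun f := by
  intro φ hφ e z hz
  have hr : (darboux φ e z).1 ∈ φ.source := φ.map_target hz.1
  obtain ⟨φ', hφ', e', h', hr', hs⟩ := hf (darboux φ e z)
  obtain ⟨T, T', hTs, hT, hev, -, -⟩ := exists_darboux_transition hφ hφ' hr hr' hz.2 h'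
  rw [← hT] at hs
  have := (hs.comp _ hTs).congr_of_eventuallyEq (hev.mono fun z hz => congrArg f hz)
  rw [darbouxCoord_darboux hφ hz] at this
  exact this.contDiffWithinAt

section PoissonRules

variable {f g g' : Conn L → ℝ}

theorem SmoothFun.mul (hf : SmoothFun f) (hg : SmoothFun g) : SmoothFun fun r => f r * g r :=
  fun φ hφ e => (hf φ hφ e).mul (hg φ hφ e)

theorem SmoothFun.sum {κ : Type*} {s : Finset κ} {f : κ → Conn L → ℝ}
    (hf : ∀ i ∈ s, SmoothFun (f i)) : SmoothFun fun r => ∑ i ∈ s, f i r :=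
  fun φ hφ e => ContDiffOn.sum fun i hi => hf i hi φ hφ e

theorem smoothFun_const (c : ℝ) : SmoothFun fun _ : Conn L => c :=
  fun _ _ _ => contDiffOn_const

theorem smoothFun_comp_proj {f : V → ℝ} (hf : ContMDiff (𝓡 n) 𝓘(ℝ, ℝ) ∞ f) :
    SmoothFun fun r : Conn L => f r.1 := by
  intro φ hφ e
  have h : ContDiffOn ℝ ∞ (fun q => f (φ.symm q)) φ.target := by
    intro q hq
    have := contDiffAt_comp_chart_symm hφ (φ.map_target hq) (hf (φ.symm q))
    rw [φ.right_inv hq] at this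
    exact this.contDiffWithinAt
  exact h.comp contDiffOn_fst fun z hz => hz.1

theorem SmoothFun.poisson (hf : SmoothFun f) (hg : SmoothFun g) :
    SmoothFun fun r => poisson f g r := by
  intro φ hφ e
  refine (contDiffOn_poissonCoord (isOpen_darbouxTarget φ e) (hf φ hφ e) (hg φ hφ e)).congr
    fun z hz => ?_
  have hr : (darboux φ e z).1 ∈ φ.source := φ.map_target hz.1
  refine (poisson_eq hφ hr hz.2 ((hf.contDiffAt hφ hr _).differentiableAt (by simp))
    ((hg.contDiffAt hφ hr _).differentiableAt (by simp))).trans ?_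
  rw [darbouxCoord_darboux hφ hz]

theorem poisson_congr {r : Conn L} {W : Set V} (hW : W ∈ 𝓝 r.1)
    (h : ∀ s : Conn L, s.1 ∈ W → g s = g' s) : poisson f g r = poisson f g' r :=
  poissonCoord_congr .rfl
    ((eventually_darboux (mem_chart_source _ _) (mem_stdFrame L r.1) hW).mono fun _ hz => h _ hz)

theorem poisson_add (hg : SmoothFun g) (hg' : SmoothFun g') (r : Conn L) :
    poisson f (fun s => g s + g' s) r = poisson f g r + poisson f g' r :=
  poissonCoord_add (hg.differentiableAt r) (hg'.differentiableAt r)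

theorem poisson_mul (hg : SmoothFun g) (hg' : SmoothFun g') (r : Conn L) :
    poisson f (fun s => g s * g' s) r = g r * poisson f g' r + poisson f g r * g' r := by
  have h := darboux_darbouxCoord (chart_mem_atlas (Eucl n) r.1) (mem_chart_source (Eucl n) r.1)
    (mem_stdFrame L r.1)
  refine (poissonCoord_mul (hg.differentiableAt r) (hg'.differentiableAt r)).trans ?_
  rw [h]
  rfl

theorem poisson_add_left (hg : SmoothFun g) (hg' : SmoothFun g') (r : Conn L) :
    poisson (fun s => g s + g' s) f r = poisson g f r + poisson g' f r :=
  poissonCoord_add_left (hg.differentiableAt r) (hg'.differentiableAt r)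

theorem poisson_smul_left (t : ℝ) (hg : SmoothFun g) (r : Conn L) :
    poisson (fun s => t * g s) f r = t * poisson g f r :=
  poissonCoord_smul_left t (hg.differentiableAt r)

theorem poisson_const (c : ℝ) (r : Conn L) : poisson f (fun _ => c) r = 0 := by
  simp [poisson, poissonCoord]

theorem poisson_sum {κ : Type*} (s : Finset κ) {g : κ → Conn L → ℝ}
    (hg : ∀ i ∈ s, SmoothFun (g i)) (r : Conn L) :
    poisson f (fun t => ∑ i ∈ s, g i t) r = ∑ i ∈ s, poisson f (g i) r := by
  classical
  induction s using Finset.induction_on with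
  | empty => simpa using poisson_const 0 r
  | insert a s ha ih =>
    simp only [Finset.sum_insert ha]
    rw [poisson_add (hg a (Finset.mem_insert_self a s))
      (.sum fun i hi => hg i (Finset.mem_insert_of_mem hi)),
      ih fun i hi => hg i (Finset.mem_insert_of_mem hi)]

end PoissonRules

end DarbouxCharts

/-! ### Hamiltonians that are linear in the momenta -/

section LinearHamiltonians

variable {n : ℕ} {V : Type u} [TopologicalSpace V] [ChartedSpace (Eucl n) V]

theorem contMDiffOn_mfderiv_apply [IsManifold (𝓡 n) ∞ V] {E : Type*} [NormedAddCommGroup E]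
    [NormedSpace ℝ E] {f : V → E} {s : Set V} (hs : IsOpen s)
    (hf : ContMDiffOn (𝓡 n) 𝓘(ℝ, E) ∞ f s) {X : ∀ x : V, TangentSpace (𝓡 n) x}
    (hX : ContMDiffOn (𝓡 n) ((𝓡 n).prod 𝓘(ℝ, Eucl n)) ∞
      (fun x => (⟨x, X x⟩ : TangentBundle (𝓡 n) V)) s) :
    ContMDiffOn (𝓡 n) 𝓘(ℝ, E) ∞ (fun x => (mfderiv (𝓡 n) 𝓘(ℝ, E) f x (X x) : E)) s := by
  have h1 := hf.contMDiffOn_tangentMapWithin (m := ∞) le_rfl hs.uniqueMDiffOn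
  have h2 := (contMDiff_snd_tangentBundle_modelSpace E 𝓘(ℝ, E) (n := ∞)).comp_contMDiffOn
    (h1.comp hX fun x hx => hx)
  refine h2.congr fun x hx => ?_
  change (mfderiv (𝓡 n) 𝓘(ℝ, E) f x (X x) : E) = mfderivWithin (𝓡 n) 𝓘(ℝ, E) f s x (X x)
  rw [mfderivWithin_of_isOpen hs hx]

/-- The representation of a vector field in a chart. -/
def coordField (φ : OpenPartialHomeomorph V (Eucl n)) (X : ∀ x : V, TangentSpace (𝓡 n) x)
    (q : Eucl n) : Eucl n :=
  mfderiv (𝓡 n) (𝓡 n) φ (φ.symm q) (X (φ.symm q))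

variable [IsManifold (𝓡 n) ∞ V] {φ : OpenPartialHomeomorph V (Eucl n)}
  {X Y : ∀ x : V, TangentSpace (𝓡 n) x}

theorem contDiffAt_coordField (hφ : φ ∈ atlas (Eucl n) V) {x : V} (hx : x ∈ φ.source)
    (hX : ContMDiff (𝓡 n) ((𝓡 n).prod 𝓘(ℝ, Eucl n)) ∞
      (fun x => (⟨x, X x⟩ : TangentBundle (𝓡 n) V))) :
    ContDiffAt ℝ ∞ (coordField φ X) (φ x) := by
  have h : ContMDiffOn (𝓡 n) 𝓘(ℝ, Eucl n) ∞
      (fun x => (mfderiv (𝓡 n) 𝓘(ℝ, Eucl n) φ x (X x) : Eucl n)) φ.source :=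
    contMDiffOn_mfderiv_apply φ.open_source
      (fun y hy => (contMDiffAt_of_mem_atlas hφ hy).contMDiffWithinAt) hX.contMDiffOn
  exact contDiffAt_comp_chart_symm hφ hx (h.contMDiffAt (φ.open_source.mem_nhds hx))

/-- The Lie bracket of vector fields in an arbitrary chart. -/
theorem mfderiv_mlieBracket (hφ : φ ∈ atlas (Eucl n) V) {x : V} (hx : x ∈ φ.source)
    (hX : ContMDiff (𝓡 n) ((𝓡 n).prod 𝓘(ℝ, Eucl n)) ∞
      (fun x => (⟨x, X x⟩ : TangentBundle (𝓡 n) V)))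
    (hY : ContMDiff (𝓡 n) ((𝓡 n).prod 𝓘(ℝ, Eucl n)) ∞
      (fun x => (⟨x, Y x⟩ : TangentBundle (𝓡 n) V))) :
    mfderiv (𝓡 n) (𝓡 n) φ x (VectorField.mlieBracket (𝓡 n) X Y x)
      = VectorField.lieBracket ℝ (coordField φ X) (coordField φ Y) (φ x) := by
  -- `mpullback` is defined with the inverse of the derivative of `φ.symm`
  have hinv : ∀ q ∈ φ.target, ∀ v : Eucl n,
      (mfderiv (𝓡 n) (𝓡 n) φ.symm q).inverse v = mfderiv (𝓡 n) (𝓡 n) φ (φ.symm q) v := by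
    intro q hq v
    have hd := mdifferentiable_of_mem_atlas (I := 𝓡 n) hφ
    exact congrArg (fun l : Eucl n →L[ℝ] Eucl n => l v)
      (ContinuousLinearMap.inverse_eq (hd.symm_comp_deriv (φ.map_target hq) ▸ by
        rw [φ.right_inv hq]) (hd.comp_symm_deriv hq))
  have hpull : ∀ X : (∀ x : V, TangentSpace (𝓡 n) x), ∀ q ∈ φ.target,
      VectorField.mpullback 𝓘(ℝ, Eucl n) (𝓡 n) φ.symm X q = coordField φ X q :=
    fun X q hq => hinv q hq _
  have hq := φ.map_source hx
  have : IsManifold (𝓡 n) (minSmoothness ℝ 2) V := by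
    rw [minSmoothness_of_isRCLikeNormedField]
    infer_instance
  have key := VectorField.mpullback_mlieBracket (I := 𝓘(ℝ, Eucl n)) (I' := 𝓡 n) (f := φ.symm)
    (x₀ := φ x) (V := X) (W := Y) (n := ∞) ((hX _).mdifferentiableAt (by simp))
    ((hY _).mdifferentiableAt (by simp)) (contMDiffAt_symm_of_mem_atlas hφ hq)
    (by simp only [minSmoothness_of_isRCLikeNormedField]; exact ENat.LEInfty.out)
  rw [hpull _ _ hq] at key
  have e1 : coordField φ (VectorField.mlieBracket (𝓡 n) X Y) (φ x)
      = mfderiv (𝓡 n) (𝓡 n) φ x (VectorField.mlieBracket (𝓡 n) X Y x) := by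
    unfold coordField
    rw [φ.left_inv hx]
  rw [← e1]
  refine key.trans ?_
  have ev : ∀ X : (∀ x : V, TangentSpace (𝓡 n) x),
      VectorField.mpullback 𝓘(ℝ, Eucl n) (𝓡 n) φ.symm X =ᶠ[𝓝 (φ x)] coordField φ X := fun X => by
    filter_upwards [φ.open_target.mem_nhds hq] with q hq using hpull X q hq
  refine (Filter.EventuallyEq.mlieBracket_vectorField_eq (ev X) (ev Y)).trans ?_
  refine (congrFun VectorField.mlieBracketWithin_univ (φ x)).symm.trans ?_
  refine (congrFun VectorField.mlieBracketWithin_eq_lieBracketWithin (φ x)).trans ?_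
  rw [VectorField.lieBracketWithin_univ]

variable {L : LineBundle n V} {e : Frame L} {c d : V → ℝ} {f g : Conn L → ℝ}

theorem eventually_eq_of_linear
    (hf : ∀ x (hx : x ∈ e.dom) (D : ConnAt L x), f ⟨x, D⟩ = D.form e hx (X x) + c x) {r : Conn L}
    (hr : r.1 ∈ φ.source) (h : r.1 ∈ e.dom) :
    (fun z => f (darboux φ e z)) =ᶠ[𝓝 (darbouxCoord φ e r h)]
      fun z => z.2 (coordField φ X z.1) + c (φ.symm z.1) := by
  filter_upwards [(isOpen_darbouxTarget φ e).mem_nhds (darbouxCoord_mem hr h)] with z hz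
  refine (hf _ hz.2 (darboux φ e z).2).trans ?_
  exact congrArg (fun a : ℝ => a + c (φ.symm z.1)) (darboux_form hz.2 _)

theorem contDiffAt_of_linear (hφ : φ ∈ atlas (Eucl n) V)
    (hX : ContMDiff (𝓡 n) ((𝓡 n).prod 𝓘(ℝ, Eucl n)) ∞
      (fun x => (⟨x, X x⟩ : TangentBundle (𝓡 n) V))) (hc : SmoothOn n c e.dom)
    (hf : ∀ x (hx : x ∈ e.dom) (D : ConnAt L x), f ⟨x, D⟩ = D.form e hx (X x) + c x) {r : Conn L}
    (hr : r.1 ∈ φ.source) (h : r.1 ∈ e.dom) :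
    ContDiffAt ℝ ∞ (fun z => f (darboux φ e z)) (darbouxCoord φ e r h) := by
  refine ContDiffAt.congr_of_eventuallyEq ?_ (eventually_eq_of_linear hf hr h)
  have f1 : ContDiffAt ℝ ∞ (fun z : Phase n => z.1) (darbouxCoord φ e r h) := contDiffAt_fst
  have f2 : ContDiffAt ℝ ∞ (fun z : Phase n => z.2) (darbouxCoord φ e r h) := contDiffAt_snd
  refine (f2.clm_apply ?_).add ?_
  · exact ContDiffAt.comp (g := coordField φ X) _ (contDiffAt_coordField hφ hr hX) f1
  · exact ContDiffAt.comp (g := fun q => c (φ.symm q)) _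
      (contDiffAt_comp_chart_symm hφ hr (hc.contMDiffAt (e.dom.isOpen.mem_nhds h))) f1

/-- The Poisson bracket of Hamiltonians that are linear in the momenta:
`{⟨p|X⟩ + c, ⟨p|Y⟩ + d} = ⟨p|[X, Y]⟩ + X d - Y c`. -/
theorem poisson_of_linear
    (hX : ContMDiff (𝓡 n) ((𝓡 n).prod 𝓘(ℝ, Eucl n)) ∞
      (fun x => (⟨x, X x⟩ : TangentBundle (𝓡 n) V)))
    (hY : ContMDiff (𝓡 n) ((𝓡 n).prod 𝓘(ℝ, Eucl n)) ∞
      (fun x => (⟨x, Y x⟩ : TangentBundle (𝓡 n) V)))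
    (hc : SmoothOn n c e.dom) (hd : SmoothOn n d e.dom)
    (hf : ∀ x (hx : x ∈ e.dom) (D : ConnAt L x), f ⟨x, D⟩ = D.form e hx (X x) + c x)
    (hg : ∀ x (hx : x ∈ e.dom) (D : ConnAt L x), g ⟨x, D⟩ = D.form e hx (Y x) + d x)
    (r : Conn L) (h : r.1 ∈ e.dom) :
    poisson f g r = r.2.form e h (VectorField.mlieBracket (𝓡 n) X Y r.1)
      + diff n d r.1 (X r.1) - diff n c r.1 (Y r.1) := by
  have hφ := chart_mem_atlas (Eucl n) r.1
  have hr := mem_chart_source (Eucl n) r.1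
  set φ := chartAt (Eucl n) r.1
  have sc := hc.contMDiffAt (e.dom.isOpen.mem_nhds h)
  have sd := hd.contMDiffAt (e.dom.isOpen.mem_nhds h)
  have dX := (contDiffAt_coordField hφ hr hX).differentiableAt (by simp)
  have dY := (contDiffAt_coordField hφ hr hY).differentiableAt (by simp)
  rw [poisson_eq hφ hr h
    ((contDiffAt_of_linear hφ hX hc hf hr h).differentiableAt (by simp))
    ((contDiffAt_of_linear hφ hY hd hg hr h).differentiableAt (by simp)),
    poissonCoord_congr (eventually_eq_of_linear hf hr h) (eventually_eq_of_linear hg hr h)]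
  refine (poissonCoord_linear dX dY
    ((contDiffAt_comp_chart_symm hφ hr sc).differentiableAt (by simp))
    ((contDiffAt_comp_chart_symm hφ hr sd).differentiableAt (by simp))
    (darbouxCoord φ e r h).2).trans ?_
  have hcoord : ∀ X : (∀ x : V, TangentSpace (𝓡 n) x),
      coordField φ X (φ r.1) = mfderiv (𝓡 n) (𝓡 n) φ r.1 (X r.1) := fun X => by
    unfold coordField
    rw [φ.left_inv hr]
  have e1 : (darbouxCoord φ e r h).2 (VectorField.lieBracket ℝ (coordField φ X) (coordField φ Y)
      (φ r.1)) = r.2.form e h (VectorField.mlieBracket (𝓡 n) X Y r.1) := by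
    rw [← mfderiv_mlieBracket hφ hr hX hY]
    exact congrArg (r.2.form e h) (mfderiv_chart_symm_comp hφ hr _)
  have e2 : ∀ {d : V → ℝ} (X : ∀ x : V, TangentSpace (𝓡 n) x),
      ContMDiffAt (𝓡 n) 𝓘(ℝ, ℝ) ∞ d r.1 →
      fderiv ℝ (fun q => d (φ.symm q)) (φ r.1) (coordField φ X (φ r.1)) = diff n d r.1 (X r.1) :=
    fun X sd => by
      rw [hcoord]
      exact (mfderiv_eq_fderiv_comp hφ hr sd _).symm
  rw [← e1, ← e2 X sd, ← e2 Y sc]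
  rfl

end LinearHamiltonians

/-! ### Sections of the algebroid and of its pullback -/

section Cutoff

variable {n : ℕ} {V : Type u} [TopologicalSpace V] [ChartedSpace (Eucl n) V]
  [IsManifold (𝓡 n) ∞ V] [T2Space V]

theorem exists_cutoff {x : V} {W : Set V} (hW : W ∈ 𝓝 x) :
    ∃ ρ : V → ℝ, ContMDiff (𝓡 n) 𝓘(ℝ, ℝ) ∞ ρ ∧ (∀ᶠ y in 𝓝 x, ρ y = 1) ∧ tsupport ρ ⊆ W := by
  obtain ⟨f, -, hf⟩ := (SmoothBumpFunction.nhds_basis_tsupport (I := 𝓡 n) x).mem_iff.1 hW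
  exact ⟨f, f.contMDiff, f.eventuallyEq_one, hf⟩

/-- The germ of a smooth function is the germ of a globally defined one. -/
theorem exists_smooth_extension {x : V} {W : Set V} (hW : IsOpen W) (hx : x ∈ W) {f : V → ℝ}
    (hf : SmoothOn n f W) :
    ∃ g : V → ℝ, ContMDiff (𝓡 n) 𝓘(ℝ, ℝ) ∞ g ∧ ∀ᶠ y in 𝓝 x, g y = f y := by
  obtain ⟨ρ, hρ, h1, hs⟩ := exists_cutoff (n := n) (hW.mem_nhds hx)
  refine ⟨fun y => ρ y * f y, fun y => ?_, h1.mono fun y hy => ?_⟩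
  by_cases hy : y ∈ tsupport ρ
  · exact (hρ y).mul (hf.contMDiffAt (hW.mem_nhds (hs hy)))
  · refine (contMDiffAt_const (c := (0 : ℝ))).congr_of_eventuallyEq ?_
    filter_upwards [(isClosed_tsupport ρ).isOpen_compl.mem_nhds hy] with z hz
    rw [image_eq_zero_of_notMem_tsupport hz, zero_mul]
  · change ρ y * f y = f y
    rw [hy, one_mul]

end Cutoff

section SectionFrames

variable (n : ℕ) {V : Type u} [TopologicalSpace V] [ChartedSpace (Eucl n) V]
  (F : Type v) [NormedAddCommGroup F] [NormedSpace ℝ F]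
  (A : V → Type w) [∀ x, AddCommGroup (A x)] [∀ x, Module ℝ (A x)]
  [∀ x, TopologicalSpace (A x)] [TopologicalSpace (TotalSpace F A)] [FiberBundle F A]

/-- Global sections of a vector bundle that form a frame over a neighbourhood `nhd` of `x`,
together with globally defined fibrewise linear functions that give the coordinates over `nhd`. -/
structure SectionFrame (x : V) where
  nhd : Set V
  isOpen : IsOpen nhd
  mem : x ∈ nhd
  sec : Fin (Module.finrank ℝ F) → Sec n F A
  dual : Fin (Module.finrank ℝ F) → ∀ y, A y →ₗ[ℝ] ℝ
  smooth_dual : ∀ i, ContMDiff ((𝓡 n).prod 𝓘(ℝ, F)) 𝓘(ℝ, ℝ) ∞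
    (fun v : TotalSpace F A => dual i v.1 v.2)
  sum_dual : ∀ y ∈ nhd, ∀ a : A y, ∑ i, dual i y a • sec i y = a

variable {n F A} in
theorem SectionFrame.smooth_dual_sec {x : V} (fr : SectionFrame n F A x)
    (i : Fin (Module.finrank ℝ F)) (ε : Sec n F A) :
    ContMDiff (𝓡 n) 𝓘(ℝ, ℝ) ∞ fun y => fr.dual i y (ε y) :=
  (fr.smooth_dual i).comp ε.contMDiff

variable [VectorBundle ℝ F A]

theorem nonempty_sectionFrame [IsManifold (𝓡 n) ∞ V] [T2Space V] [FiniteDimensional ℝ F]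
    [ContMDiffVectorBundle ∞ F A (𝓡 n)] (x : V) : Nonempty (SectionFrame n F A x) := by
  set t := trivializationAt F A x
  have hx : x ∈ t.baseSet := FiberBundle.mem_baseSet_trivializationAt' x
  let b := Module.finBasis ℝ F
  obtain ⟨ρ, hρ, h1, hs⟩ := exists_cutoff (n := n) (t.open_baseSet.mem_nhds hx)
  obtain ⟨W, hW, hWo, hxW⟩ := eventually_nhds_iff.1 (h1.and (t.open_baseSet.mem_nhds hx))
  refine ⟨⟨W, hWo, hxW, fun i => ⟨fun y => ρ y • t.localFrame b i y, ?_⟩,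
    fun i y => ρ y • (b.coord i ∘ₗ t.linearMapAt ℝ y), fun i v => ?_, fun y hy a => ?_⟩⟩
  · exact ContMDiffOn.smul_section_of_tsupport hρ.contMDiffOn t.open_baseSet hs
      (t.contMDiffOn_localFrame_baseSet ∞ b i)
  · have hp : ContMDiffAt ((𝓡 n).prod 𝓘(ℝ, F)) (𝓡 n) ∞
        (fun w : TotalSpace F A => w.1) v := contMDiffAt_proj A
    by_cases hv : v.1 ∈ tsupport ρ
    · have h2 : ContMDiffAt ((𝓡 n).prod 𝓘(ℝ, F)) 𝓘(ℝ, F) ∞ (fun w => (t w).2) v :=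
        ((t.contMDiffAt_iff (IB := 𝓡 n) (f := id) ((t.mem_source).2 (hs hv))).1
          contMDiffAt_id).2
      have h3 : ContMDiffAt ((𝓡 n).prod 𝓘(ℝ, F)) 𝓘(ℝ, ℝ) ∞
          (fun w => LinearMap.toContinuousLinearMap (b.coord i) (t w).2) v :=
        (LinearMap.toContinuousLinearMap (b.coord i)).contMDiff.contMDiffAt.comp v h2
      refine ((ContMDiffAt.comp (g := ρ) v (hρ _) hp).mul h3).congr_of_eventuallyEq ?_
      filter_upwards [hp.continuousAt.preimage_mem_nhds (t.open_baseSet.mem_nhds (hs hv))]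
        with w hw
      have : t.linearMapAt ℝ w.1 w.2 = (t w).2 := by
        rw [t.coe_linearMapAt_of_mem (R := ℝ) hw]
      change ρ w.1 * b.coord i (t.linearMapAt ℝ w.1 w.2) = _
      rw [this]
      rfl
    · refine (contMDiffAt_const (c := (0 : ℝ))).congr_of_eventuallyEq ?_
      filter_upwards [hp.continuousAt.preimage_mem_nhds
        ((isClosed_tsupport ρ).isOpen_compl.mem_nhds hv)] with w hw
      change ρ w.1 * _ = 0
      rw [image_eq_zero_of_notMem_tsupport hw, zero_mul]
  · obtain ⟨hy1, hyb⟩ := hW y hy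
    have : t.linearMapAt ℝ y a = (t ⟨y, a⟩).2 := by rw [t.coe_linearMapAt_of_mem (R := ℝ) hyb]
    change ∑ i, (ρ y * b.coord i (t.linearMapAt ℝ y a)) • ρ y • t.localFrame b i y = a
    simp only [hy1, one_mul, one_smul, t.localFrame_apply_of_mem_baseSet b hyb, this]
    have := (t.basisAt b hyb).sum_repr a
    simpa [Trivialization.basisAt] using this

variable {n F A}

theorem Sec.sum_apply {κ : Type*} (s : Finset κ) (ε : κ → Sec n F A) (x : V) :
    (∑ i ∈ s, ε i) x = ∑ i ∈ s, ε i x := by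
  classical
  induction s using Finset.induction_on with
  | empty => rfl
  | insert a s ha ih =>
    rw [Finset.sum_insert ha, Finset.sum_insert ha, ← ih]
    rfl

/-- Every vector is the value of a global section. -/
theorem exists_sec_apply_eq [IsManifold (𝓡 n) ∞ V] [T2Space V] [FiniteDimensional ℝ F]
    [ContMDiffVectorBundle ∞ F A (𝓡 n)] {x : V} (a : A x) : ∃ ε : Sec n F A, ε x = a := by
  obtain ⟨fr⟩ := nonempty_sectionFrame n F A x
  refine ⟨∑ i, fr.dual i x a • fr.sec i, ?_⟩
  rw [Sec.sum_apply]
  exact fr.sum_dual x fr.mem a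

end SectionFrames

namespace LieAlgebroid

variable {n : ℕ} {V : Type u} [TopologicalSpace V] [ChartedSpace (Eucl n) V]
  [IsManifold (𝓡 n) ∞ V]
  {F : Type v} [NormedAddCommGroup F] [NormedSpace ℝ F]
  {A : V → Type w} [∀ x, AddCommGroup (A x)] [∀ x, Module ℝ (A x)]
  [∀ x, TopologicalSpace (A x)] [TopologicalSpace (TotalSpace F A)] [FiberBundle F A]
  [VectorBundle ℝ F A] (𝒜 : LieAlgebroid n F A)

theorem smooth_anchor (ε : Sec n F A) :
    ContMDiff (𝓡 n) ((𝓡 n).prod 𝓘(ℝ, Eucl n)) ∞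
      (fun x => (⟨x, 𝒜.anchor x (ε x)⟩ : TangentBundle (𝓡 n) V)) :=
  𝒜.anchor_smooth.comp ε.contMDiff

theorem bracket_skew (ε₁ ε₂ : Sec n F A) : 𝒜.bracket ε₁ ε₂ = - 𝒜.bracket ε₂ ε₁ := by
  have h := 𝒜.bracket_self (ε₁ + ε₂)
  simp only [map_add, LinearMap.add_apply, 𝒜.bracket_self, zero_add, add_zero] at h
  exact eq_neg_of_add_eq_zero_right h

theorem bracket_eq_zero_of_eventually [T2Space V] (ε : Sec n F A) {η : Sec n F A} {x : V}
    (h : ∀ᶠ y in 𝓝 x, η y = 0) : 𝒜.bracket ε η x = 0 := by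
  obtain ⟨ρ, hρ, h1, hs⟩ := exists_cutoff (n := n) h
  have h0 : fsmul n F A ρ hρ η = 0 := by
    ext y
    change ρ y • η y = 0
    by_cases hy : y ∈ tsupport ρ
    · rw [show η y = 0 from hs hy, smul_zero]
    · rw [image_eq_zero_of_notMem_tsupport hy, zero_smul]
  have := 𝒜.leibniz ρ hρ ε η x
  rw [h0, map_zero, h1.self_of_nhds, h.self_of_nhds, smul_zero, one_smul, add_zero] at this
  exact this.symm

/-- The bracket in terms of a local expression of the second section. -/
theorem bracket_eq_sum [T2Space V] (ε η : Sec n F A) {κ : Type*} [Fintype κ] (g : κ → V → ℝ)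
    (hg : ∀ i, ContMDiff (𝓡 n) 𝓘(ℝ, ℝ) ∞ (g i)) (ξ : κ → Sec n F A) {x : V}
    (h : ∀ᶠ y in 𝓝 x, η y = ∑ i, g i y • ξ i y) :
    𝒜.bracket ε η x = ∑ i, (g i x • 𝒜.bracket ε (ξ i) x + 𝒜.der ε (g i) x • ξ i x) := by
  have h0 : 𝒜.bracket ε (η - ∑ i, fsmul n F A (g i) (hg i) (ξ i)) x = 0 := by
    refine 𝒜.bracket_eq_zero_of_eventually ε ?_
    filter_upwards [h] with y hy
    change η y - (∑ i, fsmul n F A (g i) (hg i) (ξ i)) y = 0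
    rw [Sec.sum_apply, hy]
    exact sub_self _
  rw [map_sub, map_sum] at h0
  rw [eq_of_sub_eq_zero (a := 𝒜.bracket ε η x) h0, Sec.sum_apply]
  exact Finset.sum_congr rfl fun i _ => 𝒜.leibniz (g i) (hg i) ε (ξ i) x

end LieAlgebroid

section SectionsAlong

variable {n : ℕ} {V : Type u} [TopologicalSpace V] [ChartedSpace (Eucl n) V]
  {F : Type v} [NormedAddCommGroup F] [NormedSpace ℝ F]
  {A : V → Type w} [∀ x, AddCommGroup (A x)] [∀ x, Module ℝ (A x)]
  [∀ x, TopologicalSpace (A x)] [TopologicalSpace (TotalSpace F A)] [FiberBundle F A]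
  [VectorBundle ℝ F A]

/-- Smooth linear combinations of smooth sections along a map to the base of a vector bundle. -/
theorem contMDiffAt_sum_smul_along {E : Type*} [NormedAddCommGroup E] [NormedSpace ℝ E]
    {b : E → V} {z : E} (hb : ContMDiffAt 𝓘(ℝ, E) (𝓡 n) ∞ b z) {κ : Type*} (s : Finset κ)
    {f : κ → E → ℝ} (hf : ∀ i ∈ s, ContDiffAt ℝ ∞ (f i) z) {σ : κ → ∀ y, A (b y)}
    (hσ : ∀ i ∈ s, ContMDiffAt 𝓘(ℝ, E) ((𝓡 n).prod 𝓘(ℝ, F)) ∞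
      (fun y => (⟨b y, σ i y⟩ : TotalSpace F A)) z) :
    ContMDiffAt 𝓘(ℝ, E) ((𝓡 n).prod 𝓘(ℝ, F)) ∞
      (fun y => (⟨b y, ∑ i ∈ s, f i y • σ i y⟩ : TotalSpace F A)) z := by
  refine contMDiffAt_totalSpace.2 ⟨hb, ?_⟩
  have h : ContDiffAt ℝ ∞ (fun y => ∑ i ∈ s, f i y •
      (trivializationAt F A (b z) ⟨b y, σ i y⟩).2) z :=
    ContDiffAt.sum fun i hi => (hf i hi).smul (contMDiffAt_totalSpace.1 (hσ i hi)).2.contDiffAt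
  refine h.contMDiffAt.congr_of_eventuallyEq ?_
  filter_upwards [hb.continuousAt.preimage_mem_nhds
    ((trivializationAt F A (b z)).open_baseSet.mem_nhds
      (FiberBundle.mem_baseSet_trivializationAt' (b z)))] with y hy
  have e : ∀ v : A (b y), (trivializationAt F A (b z) ⟨b y, v⟩).2
      = (trivializationAt F A (b z)).linearEquivAt ℝ (b y) hy v := fun _ => rfl
  simp only [e, map_sum, map_smul]

end SectionsAlong

section PullbackSections

variable {n : ℕ} {V : Type u} [TopologicalSpace V] [ChartedSpace (Eucl n) V]
  {F : Type v} [NormedAddCommGroup F] [NormedSpace ℝ F]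
  {A : V → Type w} [∀ x, TopologicalSpace (A x)] [TopologicalSpace (TotalSpace F A)]
  [FiberBundle F A]

variable [IsManifold (𝓡 n) ∞ V] {L : LineBundle n V}

theorem smoothFun_of_eventually_eq {f : Conn L → ℝ} (h : ∀ r : Conn L, ∃ W ∈ 𝓝 r.1,
    ∃ g : Conn L → ℝ, SmoothFun g ∧ ∀ s : Conn L, s.1 ∈ W → f s = g s) : SmoothFun f := by
  refine smoothFun_of_exists fun r => ⟨chartAt _ r.1, chart_mem_atlas _ _, stdFrame L r.1,
    mem_stdFrame L r.1, mem_chart_source _ _, ?_⟩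
  obtain ⟨W, hW, g, hg, hfg⟩ := h r
  refine (hg.contDiffAt (chart_mem_atlas _ _) (mem_chart_source _ _)
    (mem_stdFrame L r.1)).congr_of_eventuallyEq ?_
  filter_upwards [eventually_darboux (mem_chart_source _ _) (mem_stdFrame L r.1) hW] with z hz
    using hfg _ hz

variable {σ : ∀ r : Conn L, A r.1}

theorem smoothSec_of_eventually_eq (h : ∀ r : Conn L, ∃ W ∈ 𝓝 r.1,
    ∃ τ : (∀ r : Conn L, A r.1), SmoothSec F τ ∧ ∀ s : Conn L, s.1 ∈ W → σ s = τ s) :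
    SmoothSec F σ := by
  intro φ hφ e z hz
  have hr : (darboux φ e z).1 ∈ φ.source := φ.map_target hz.1
  obtain ⟨W, hW, τ, hτ, hst⟩ := h (darboux φ e z)
  refine (((hτ φ hφ e).contMDiffAt ((isOpen_darbouxTarget φ e).mem_nhds hz)).congr_of_eventuallyEq
    ?_).contMDiffWithinAt
  have := eventually_darboux hr hz.2 hW
  rw [darbouxCoord_darboux hφ hz] at this
  filter_upwards [this] with y hy
  rw [hst _ hy]

theorem smoothSec_comp_proj (ε : Sec n F A) : SmoothSec F fun r : Conn L => ε r.1 := by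
  intro φ hφ e z hz
  have hb : ContMDiffAt 𝓘(ℝ, Phase n) (𝓡 n) ∞ (fun z => (darboux φ e z).1) z :=
    ContMDiffAt.comp (g := φ.symm) z (contMDiffAt_symm_of_mem_atlas hφ hz.1)
      contDiffAt_fst.contMDiffAt
  exact (ContMDiffAt.comp (g := fun x => (⟨x, ε x⟩ : TotalSpace F A)) z (ε.contMDiff _)
    hb).contMDiffWithinAt

variable [∀ x, AddCommGroup (A x)] [∀ x, Module ℝ (A x)]

theorem SmoothSec.smoothFun_dual (hσ : SmoothSec F σ) {x : V} (fr : SectionFrame n F A x)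
    (i : Fin (Module.finrank ℝ F)) : SmoothFun fun r => fr.dual i r.1 (σ r) := fun φ hφ e =>
  ((fr.smooth_dual i).comp_contMDiffOn (hσ φ hφ e)).contDiffOn

variable [VectorBundle ℝ F A]

theorem smoothSec_sum_smul {κ : Type*} (s : Finset κ) {f : κ → Conn L → ℝ}
    (hf : ∀ i ∈ s, SmoothFun (f i)) {σ : κ → ∀ r : Conn L, A r.1}
    (hσ : ∀ i ∈ s, SmoothSec F (σ i)) :
    SmoothSec F fun r => ∑ i ∈ s, f i r • σ i r := by
  intro φ hφ e z hz
  have hz' := (isOpen_darbouxTarget φ e).mem_nhds hz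
  have hb : ContMDiffAt 𝓘(ℝ, Phase n) (𝓡 n) ∞ (fun z => (darboux φ e z).1) z :=
    ContMDiffAt.comp (g := φ.symm) z (contMDiffAt_symm_of_mem_atlas hφ hz.1)
      contDiffAt_fst.contMDiffAt
  exact (contMDiffAt_sum_smul_along (f := fun i y => f i (darboux φ e y))
    (σ := fun i y => σ i (darboux φ e y)) hb s
    (fun i hi => (hf i hi φ hφ e).contDiffAt hz')
    fun i hi => (hσ i hi φ hφ e).contMDiffAt hz').contMDiffWithinAt

end PullbackSections

/-! ### The local form of a lift -/

section

variable {n : ℕ} {V : Type u} [TopologicalSpace V] [ChartedSpace (Eucl n) V]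
  [IsManifold (𝓡 n) ∞ V]
  {F : Type v} [NormedAddCommGroup F] [NormedSpace ℝ F]
  {A : V → Type w} [∀ x, AddCommGroup (A x)] [∀ x, Module ℝ (A x)]
  [∀ x, TopologicalSpace (A x)] [TopologicalSpace (TotalSpace F A)] [FiberBundle F A]
  [VectorBundle ℝ F A] {𝒜 : LieAlgebroid n F A}

namespace HamLift

section LinearInMomenta

variable {L : LineBundle n V} (H : HamLift 𝒜 L)

/-- The derivative of a Hamiltonian in the direction of the momenta is the anchor. -/
theorem fderiv_ham_momentum [T2Space V] {e : Frame L} (ε : Sec n F A) {r : Conn L}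
    (h : r.1 ∈ e.dom) (ξ : Eucl n →L[ℝ] ℝ) :
    fderiv ℝ (fun z => H.ham (darboux (chartAt (Eucl n) r.1) e z)
        (ε (darboux (chartAt (Eucl n) r.1) e z).1))
      (darbouxCoord (chartAt (Eucl n) r.1) e r h) (0, ξ)
      = ξ (mfderiv (𝓡 n) (𝓡 n) (chartAt (Eucl n) r.1) r.1 (𝒜.anchor r.1 (ε r.1))) := by
  have hφ := chart_mem_atlas (Eucl n) r.1
  have hr := mem_chart_source (Eucl n) r.1
  set φ := chartAt (Eucl n) r.1
  set X : Eucl n := mfderiv (𝓡 n) (𝓡 n) φ r.1 (𝒜.anchor r.1 (ε r.1)) with hX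
  set z₀ := darbouxCoord φ e r h
  set l := fderiv ℝ (fun z => H.ham (darboux φ e z) (ε (darboux φ e z).1)) z₀
  -- the bracket with (an extension of) the linear function `μ` of the coordinates
  have key : ∀ μ : Eucl n →L[ℝ] ℝ, ∑ a, l (dirP a) * μ (EuclideanSpace.single a 1) = μ X := by
    intro μ
    have hs : SmoothOn n (fun y => μ (φ y)) φ.source := fun y hy =>
      (μ.contDiff.contMDiff.contMDiffAt.comp y (contMDiffAt_of_mem_atlas hφ hy)).contMDiffWithinAt
    obtain ⟨f, hf, hfe⟩ := exists_smooth_extension φ.open_source hr hs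
    have hφs : ContinuousAt φ.symm (φ r.1) := φ.continuousAt_symm (φ.map_source hr)
    have hloc : (fun q => f (φ.symm q)) =ᶠ[𝓝 (φ r.1)] μ := by
      have h1 : ∀ᶠ q in 𝓝 (φ r.1), f (φ.symm q) = μ (φ (φ.symm q)) := by
        refine hφs.eventually (p := fun y => f y = μ (φ y)) ?_
        rwa [φ.left_inv hr]
      filter_upwards [h1, φ.open_target.mem_nhds (φ.map_source hr)] with q hq hq'
      rw [hq, φ.right_inv hq']
    have h2 := H.covers ε f hf r
    rw [poisson_eq hφ hr h (((H.ham_smooth ε).contDiffAt hφ hr h).differentiableAt (by simp))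
      (((smoothFun_comp_proj hf).contDiffAt hφ hr h).differentiableAt (by simp))] at h2
    have h3 : DifferentiableAt ℝ (fun q => f (φ.symm q)) z₀.1 :=
      (contDiffAt_comp_chart_symm hφ hr (hf r.1)).differentiableAt (by simp)
    have h4 := poissonCoord_fst (h := fun z => H.ham (darboux φ e z) (ε (darboux φ e z).1)) h3
    have h5 : 𝒜.der ε f r.1 = μ X := by
      refine (mfderiv_eq_fderiv_comp hφ hr (hf r.1) _).trans ?_
      rw [hloc.fderiv_eq, μ.fderiv]
    have h6 : fderiv ℝ (fun q => f (φ.symm q)) z₀.1 = μ := by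
      change fderiv ℝ (fun q => f (φ.symm q)) (φ r.1) = μ
      rw [hloc.fderiv_eq, μ.fderiv]
    rw [h6] at h4
    rw [← h4, ← h5]
    exact h2
  have hξ : ((0, ξ) : Phase n) = ∑ a, ξ (EuclideanSpace.single a 1) • dirP a := by
    conv_lhs => rw [phase_eq_sum (0, ξ)]
    simp
  rw [hξ, map_sum, ← key ξ]
  refine Finset.sum_congr rfl fun a _ => ?_
  rw [map_smul, smul_eq_mul, mul_comm]

/-- The Hamiltonians of a lift depend on the momenta as `⟨p|δ_ε⟩`: two connections at the same point
have values that differ by the pairing of the difference with the anchor. -/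
theorem ham_sub_ham [T2Space V] [FiniteDimensional ℝ F] [ContMDiffVectorBundle ∞ F A (𝓡 n)]
    {e : Frame L} {x : V} (hx : x ∈ e.dom) (D D' : ConnAt L x) (a : A x) :
    H.ham ⟨x, D⟩ a - D.form e hx (𝒜.anchor x a)
      = H.ham ⟨x, D'⟩ a - D'.form e hx (𝒜.anchor x a) := by
  obtain ⟨ε, rfl⟩ := exists_sec_apply_eq (n := n) (F := F) a
  have hφ := chart_mem_atlas (Eucl n) x
  have hr := mem_chart_source (Eucl n) x
  set φ := chartAt (Eucl n) x with hφdef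
  set X : Eucl n := mfderiv (𝓡 n) (𝓡 n) φ x (𝒜.anchor x (ε x)) with hX
  -- the difference of the Hamiltonian and `⟨p|δ_ε⟩` as a function on the fibre over `x`
  let k : (Eucl n →L[ℝ] ℝ) → ℝ := fun p =>
    H.ham (darboux φ e (φ x, p)) (ε (darboux φ e (φ x, p)).1) - p X
  have hd : ∀ p, HasFDerivAt k (0 : (Eucl n →L[ℝ] ℝ) →L[ℝ] ℝ) p := by
    intro p
    have hz : ((φ x, p) : Phase n) ∈ darbouxTarget φ e := by
      refine ⟨φ.map_source hr, ?_⟩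
      change φ.symm (φ x) ∈ e.dom
      rwa [φ.left_inv hr]
    have hx1 : (darboux φ e (φ x, p)).1 = x := φ.left_inv hr
    have hd1 : DifferentiableAt ℝ (fun z => H.ham (darboux φ e z) (ε (darboux φ e z).1))
        ((φ x, p) : Phase n) :=
      (((H.ham_smooth ε) φ hφ e).contDiffAt
        ((isOpen_darbouxTarget φ e).mem_nhds hz)).differentiableAt (by simp)
    have hd2 : HasFDerivAt (fun p : Eucl n →L[ℝ] ℝ => ((φ x, p) : Phase n))
        (ContinuousLinearMap.inr ℝ (Eucl n) (Eucl n →L[ℝ] ℝ)) p :=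
      hasFDerivAt_prodMk_right (φ x) p
    have hd3 : HasFDerivAt (fun p : Eucl n →L[ℝ] ℝ => p X)
        (ContinuousLinearMap.apply ℝ ℝ X) p :=
      (ContinuousLinearMap.apply ℝ ℝ X).hasFDerivAt
    have hd4 := (HasFDerivAt.comp p hd1.hasFDerivAt hd2).sub hd3
    refine hd4.congr_fderiv (ContinuousLinearMap.ext fun ξ => ?_)
    have hkey : ∀ (s : Conn L) (hs : s.1 = x) (hse : s.1 ∈ e.dom),
        fderiv ℝ (fun z => H.ham (darboux φ e z) (ε (darboux φ e z).1))
          (darbouxCoord φ e s hse) (0, ξ) = ξ X := by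
      rintro ⟨y, D⟩ rfl hse
      exact H.fderiv_ham_momentum ε hse ξ
    have := hkey (darboux φ e (φ x, p)) hx1 hz.2
    rw [darbouxCoord_darboux hφ hz] at this
    change fderiv ℝ (fun z => H.ham (darboux φ e z) (ε (darboux φ e z).1)) (φ x, p) (0, ξ) - ξ X = 0
    rw [this, sub_self]
  have hconst : ∀ p p', k p = k p' := fun p p' =>
    is_const_of_fderiv_eq_zero (𝕜 := ℝ) (fun p => (hd p).differentiableAt) (fun p => (hd p).fderiv)
      p p'
  have hk : ∀ D : ConnAt L x, k (darbouxCoord φ e ⟨x, D⟩ hx).2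
      = H.ham ⟨x, D⟩ (ε x) - D.form e hx (𝒜.anchor x (ε x)) := by
    intro D
    have h1 := darboux_darbouxCoord hφ (r := ⟨x, D⟩) hr hx
    have h2 : (darbouxCoord φ e ⟨x, D⟩ hx).2 X = D.form e hx (𝒜.anchor x (ε x)) :=
      congrArg (D.form e hx) (mfderiv_chart_symm_comp hφ hr _)
    change H.ham (darboux φ e (darbouxCoord φ e ⟨x, D⟩ hx))
      (ε (darboux φ e (darbouxCoord φ e ⟨x, D⟩ hx)).1) - _ = _
    rw [h1, h2]
  rw [← hk D, ← hk D']
  exact hconst _ _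

open Classical in
/-- The momentum-independent part `c_e` of the Hamiltonians in the frame `e`: the value at the
connection with `p_e = 0`. It is extended by zero outside the domain of `e`. -/
def potential (e : Frame L) (x : V) : A x →ₗ[ℝ] ℝ :=
  if hx : x ∈ e.dom then H.ham ⟨x, ConnAt.ofForm e hx 0⟩ else 0

theorem potential_of_mem {e : Frame L} {x : V} (hx : x ∈ e.dom) :
    H.potential e x = H.ham ⟨x, ConnAt.ofForm e hx 0⟩ :=
  dif_pos hx

theorem ham_eq [T2Space V] [FiniteDimensional ℝ F] [ContMDiffVectorBundle ∞ F A (𝓡 n)]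
    (e : Frame L) (x : V) (hx : x ∈ e.dom) (D : ConnAt L x) (a : A x) :
    H.ham ⟨x, D⟩ a = D.form e hx (𝒜.anchor x a) + H.potential e x a := by
  have h := H.ham_sub_ham hx D (ConnAt.ofForm e hx 0) a
  rw [ConnAt.ofForm_form] at h
  rw [H.potential_of_mem hx]
  have h0 : (0 : Cotangent n x) (𝒜.anchor x a) = 0 := rfl
  rw [h0, sub_zero] at h
  rw [← h]
  ring

theorem smoothOn_potential (e : Frame L) (ε : Sec n F A) :
    SmoothOn n (fun x => H.potential e x (ε x)) e.dom := by
  intro x hx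
  have hφ := chart_mem_atlas (Eucl n) x
  have hr := mem_chart_source (Eucl n) x
  set φ := chartAt (Eucl n) x
  have h1 : ContMDiffAt (𝓡 n) 𝓘(ℝ, Phase n) ∞ (fun y => ((φ y, 0) : Phase n)) x :=
    (contDiff_prodMk_left (0 : Eucl n →L[ℝ] ℝ)).contMDiff.contMDiffAt.comp x
      (contMDiffAt_of_mem_atlas hφ hr)
  have hz : ((φ x, 0) : Phase n) ∈ darbouxTarget φ e := by
    refine ⟨φ.map_source hr, ?_⟩
    change φ.symm (φ x) ∈ e.dom
    rwa [φ.left_inv hr]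
  have h2 : ContMDiffAt 𝓘(ℝ, Phase n) 𝓘(ℝ, ℝ) ∞
      (fun z => H.ham (darboux φ e z) (ε (darboux φ e z).1)) ((φ x, 0) : Phase n) :=
    (((H.ham_smooth ε) φ hφ e).contDiffAt
      ((isOpen_darbouxTarget φ e).mem_nhds hz)).contMDiffAt
  refine ((ContMDiffAt.comp x h2 h1).congr_of_eventuallyEq ?_).contMDiffWithinAt
  filter_upwards [e.dom.isOpen.mem_nhds hx, φ.open_source.mem_nhds hr] with y hy hys
  have hl : φ.symm (φ y) ∈ e.dom := by rwa [φ.left_inv hys]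
  have h3 : darboux φ e (φ y, 0) = ⟨y, ConnAt.ofForm e hy 0⟩ := by
    refine conn_ext (e := e) (φ.left_inv hys) hl hy fun v => ?_
    rw [ConnAt.ofForm_form]
    exact darboux_form hl v
  rw [H.potential_of_mem hy]
  change _ = H.ham (darboux φ e (φ y, 0)) (ε (darboux φ e (φ y, 0)).1)
  rw [h3]

/-- The cocycle equation of `c_e` is the part of `{h_ε₁, h_ε₂} = h_⌊ε₁,ε₂⌋` that does not contain the
momenta. -/
theorem potential_closed [T2Space V] [FiniteDimensional ℝ F] [ContMDiffVectorBundle ∞ F A (𝓡 n)]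
    (e : Frame L) (ε₁ ε₂ : Sec n F A) (x : V) (hx : x ∈ e.dom) :
    H.potential e x (𝒜.bracket ε₁ ε₂ x) = 𝒜.der ε₁ (fun y => H.potential e y (ε₂ y)) x
      - 𝒜.der ε₂ (fun y => H.potential e y (ε₁ y)) x := by
  let r : Conn L := ⟨x, ConnAt.ofForm e hx 0⟩
  have h := poisson_of_linear (𝒜.smooth_anchor ε₁) (𝒜.smooth_anchor ε₂)
    (H.smoothOn_potential e ε₁) (H.smoothOn_potential e ε₂)
    (f := fun s => H.ham s (ε₁ s.1)) (g := fun s => H.ham s (ε₂ s.1))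
    (fun x hx D => H.ham_eq e x hx D _) (fun x hx D => H.ham_eq e x hx D _) r hx
  rw [H.ham_bracket, 𝒜.anchor_bracket, H.ham_eq e x hx] at h
  have h' : H.potential e x (𝒜.bracket ε₁ ε₂ x)
      + (ConnAt.ofForm e hx 0).form e hx (𝒜.anchor x (𝒜.bracket ε₁ ε₂ x))
      = (ConnAt.ofForm e hx 0).form e hx (𝒜.anchor x (𝒜.bracket ε₁ ε₂ x))
        + 𝒜.der ε₁ (fun y => H.potential e y (ε₂ y)) x
        - 𝒜.der ε₂ (fun y => H.potential e y (ε₁ y)) x := by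
    rw [add_comm]
    exact h
  linarith

end LinearInMomenta

/-- Hamiltonians that are locally of the form `⟨p_e|δ_ε⟩ + c_e(ε)` with closed `c_e` define a lift
of the anchor action. -/
def ofLocal (L : LineBundle n V) (ham : ∀ r : Conn L, A r.1 →ₗ[ℝ] ℝ)
    (h : ∀ x : V, ∃ (e : Frame L) (c : ∀ x, A x →ₗ[ℝ] ℝ), x ∈ e.dom ∧
      (∀ ε : Sec n F A, SmoothOn n (fun x => c x (ε x)) e.dom) ∧
      (∀ (ε₁ ε₂ : Sec n F A), ∀ x ∈ e.dom, c x (𝒜.bracket ε₁ ε₂ x)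
        = 𝒜.der ε₁ (fun y => c y (ε₂ y)) x - 𝒜.der ε₂ (fun y => c y (ε₁ y)) x) ∧
      ∀ x (hx : x ∈ e.dom) (D : ConnAt L x) (a : A x),
        ham ⟨x, D⟩ a = D.form e hx (𝒜.anchor x a) + c x a) : HamLift 𝒜 L where
  ham := ham
  ham_smooth ε := smoothFun_of_exists fun r => by
    obtain ⟨e, c, hx, hc, -, hh⟩ := h r.1
    exact ⟨chartAt _ r.1, chart_mem_atlas _ _, e, hx, mem_chart_source _ _,
      contDiffAt_of_linear (chart_mem_atlas _ _) (𝒜.smooth_anchor ε) (hc ε)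
        (f := fun s => ham s (ε s.1)) (fun x hx D => hh x hx D _) (mem_chart_source _ _) hx⟩
  covers ε f hf r := by
    obtain ⟨e, c, hx, hc, -, hh⟩ := h r.1
    have h0 : ContMDiff (𝓡 n) ((𝓡 n).prod 𝓘(ℝ, Eucl n)) ∞
        (fun x => (⟨x, 0⟩ : TangentBundle (𝓡 n) V)) :=
      contMDiff_zeroSection ℝ (TangentSpace (𝓡 n) : V → Type _)
    have h1 := poisson_of_linear (𝒜.smooth_anchor ε) h0 (hc ε) hf.contMDiffOn
      (f := fun s => ham s (ε s.1)) (g := fun s => f s.1)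
      (fun x hx D => hh x hx D _) (fun x hx D => (zero_add (f x)).symm.trans
        (congrArg (fun a : ℝ => a + f x) (map_zero (D.form e hx)).symm)) r hx
    have h2 : VectorField.mlieBracket (𝓡 n) (fun x => 𝒜.anchor x (ε x)) (fun _ => 0) r.1 = 0 :=
      congrFun (VectorField.mlieBracket_zero_right (I := 𝓡 n)) r.1
    rw [h2, map_zero, map_zero] at h1
    refine h1.trans ?_
    change (0 : ℝ) + 𝒜.der ε f r.1 - 0 = _
    rw [zero_add, sub_zero]
  ham_bracket ε₁ ε₂ r := by
    obtain ⟨e, c, hx, hc, hcl, hh⟩ := h r.1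
    have h1 := poisson_of_linear (𝒜.smooth_anchor ε₁) (𝒜.smooth_anchor ε₂) (hc ε₁) (hc ε₂)
      (f := fun s => ham s (ε₁ s.1)) (g := fun s => ham s (ε₂ s.1))
      (fun x hx D => hh x hx D _) (fun x hx D => hh x hx D _) r hx
    rw [𝒜.anchor_bracket] at h1
    refine h1.trans ((hh r.1 hx r.2 _).trans ?_).symm
    rw [hcl ε₁ ε₂ r.1 hx]
    exact (add_sub_assoc _ _ _).symm

end HamLift

end

/-! ### The Hamiltonian algebroid of a lift -/

section

variable {n : ℕ} {V : Type u} [TopologicalSpace V] [ChartedSpace (Eucl n) V]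
  [IsManifold (𝓡 n) ∞ V]
  {F : Type v} [NormedAddCommGroup F] [NormedSpace ℝ F]
  {A : V → Type w} [∀ x, AddCommGroup (A x)] [∀ x, Module ℝ (A x)]
  [∀ x, TopologicalSpace (A x)] [TopologicalSpace (TotalSpace F A)] [FiberBundle F A]
  [VectorBundle ℝ F A] {𝒜 : LieAlgebroid n F A}

namespace HamLift

section HamiltonianBracket

variable [T2Space V] [FiniteDimensional ℝ F] [ContMDiffVectorBundle ∞ F A (𝓡 n)]
  {L : LineBundle n V} (H : HamLift 𝒜 L)

variable (n F A) in
/-- A choice of a frame of global sections near each point. -/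
def sectionFrameAt (x : V) : SectionFrame n F A x :=
  (nonempty_sectionFrame n F A x).some

/-- The bracket of a section of `A` with a section `σ` of the pull-back bundle, computed in a frame
`ε_i` of sections of `A`: if `σ = ∑ f_i ε_i`, it is `∑ (f_i ⌊ε, ε_i⌋ + {h_ε, f_i} ε_i)`. By
`pullbackBracket_eq` it does not depend on the frame. -/
def pullbackBracket (ε : Sec n F A) (σ : ∀ r : Conn L, A r.1) (r : Conn L) : A r.1 :=
  ∑ i, ((sectionFrameAt n F A r.1).dual i r.1 (σ r)
      • 𝒜.bracket ε ((sectionFrameAt n F A r.1).sec i) r.1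
    + poisson (fun s : Conn L => H.ham s (ε s.1))
      (fun s => (sectionFrameAt n F A r.1).dual i s.1 (σ s)) r
      • (sectionFrameAt n F A r.1).sec i r.1)

/-- The bracket in terms of an arbitrary local expression `σ = ∑ f_k η_k`. -/
theorem pullbackBracket_eq (ε : Sec n F A) {σ : ∀ r : Conn L, A r.1} {r : Conn L} {κ : Type*}
    [Fintype κ] {f : κ → Conn L → ℝ} (hf : ∀ k, SmoothFun (f k)) (η : κ → Sec n F A) {W : Set V}
    (hW : W ∈ 𝓝 r.1) (hσ : ∀ s : Conn L, s.1 ∈ W → σ s = ∑ k, f k s • η k s.1) :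
    H.pullbackBracket ε σ r = ∑ k, (f k r • 𝒜.bracket ε (η k) r.1
      + poisson (fun s : Conn L => H.ham s (ε s.1)) (f k) r • η k r.1) := by
  unfold pullbackBracket
  set fr := sectionFrameAt n F A r.1
  let g : κ → Fin (Module.finrank ℝ F) → V → ℝ := fun k i y => fr.dual i y (η k y)
  have hg : ∀ k i, ContMDiff (𝓡 n) 𝓘(ℝ, ℝ) ∞ (g k i) := fun k i => fr.smooth_dual_sec i (η k)
  have e1 : ∀ i, ∀ s : Conn L, s.1 ∈ W → fr.dual i s.1 (σ s) = ∑ k, f k s * g k i s.1 := by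
    intro i s hs
    rw [hσ s hs, map_sum]
    exact Finset.sum_congr rfl fun k _ => map_smul _ _ _
  have e2 : ∀ i, poisson (fun s : Conn L => H.ham s (ε s.1)) (fun s => fr.dual i s.1 (σ s)) r
      = ∑ k, (f k r * 𝒜.der ε (g k i) r.1
        + poisson (fun s : Conn L => H.ham s (ε s.1)) (f k) r * g k i r.1) := by
    intro i
    rw [poisson_congr hW (e1 i),
      poisson_sum _ fun k _ => (hf k).mul (smoothFun_comp_proj (hg k i))]
    refine Finset.sum_congr rfl fun k _ => ?_
    rw [poisson_mul (hf k) (smoothFun_comp_proj (hg k i)), H.covers ε _ (hg k i)]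
  have e3 : ∀ k, 𝒜.bracket ε (η k) r.1
      = ∑ i, (g k i r.1 • 𝒜.bracket ε (fr.sec i) r.1 + 𝒜.der ε (g k i) r.1 • fr.sec i r.1) :=
    fun k => 𝒜.bracket_eq_sum ε (η k) (g k) (hg k) fr.sec (by
      filter_upwards [fr.isOpen.mem_nhds fr.mem] with y hy
      exact (fr.sum_dual y hy _).symm)
  have e4 : ∀ k, η k r.1 = ∑ i, g k i r.1 • fr.sec i r.1 :=
    fun k => (fr.sum_dual r.1 fr.mem _).symm
  have lhs : ∀ i, fr.dual i r.1 (σ r) • 𝒜.bracket ε (fr.sec i) r.1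
      + poisson (fun s : Conn L => H.ham s (ε s.1)) (fun s => fr.dual i s.1 (σ s)) r
        • fr.sec i r.1
      = ∑ k, ((f k r * g k i r.1) • 𝒜.bracket ε (fr.sec i) r.1
        + (f k r * 𝒜.der ε (g k i) r.1
          + poisson (fun s : Conn L => H.ham s (ε s.1)) (f k) r * g k i r.1) • fr.sec i r.1) := by
    intro i
    rw [e2 i, e1 i r (mem_of_mem_nhds hW), Finset.sum_smul, Finset.sum_smul,
      ← Finset.sum_add_distrib]
  rw [Finset.sum_congr rfl fun i _ => lhs i, Finset.sum_comm]
  refine Finset.sum_congr rfl fun k _ => ?_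
  rw [e3 k, e4 k, Finset.smul_sum, Finset.smul_sum, ← Finset.sum_add_distrib]
  refine Finset.sum_congr rfl fun i _ => ?_
  module

theorem pullbackBracket_comp_proj (ε₁ ε₂ : Sec n F A) (r : Conn L) :
    H.pullbackBracket ε₁ (fun s => ε₂ s.1) r = 𝒜.bracket ε₁ ε₂ r.1 := by
  rw [H.pullbackBracket_eq (κ := Unit) ε₁ (f := fun _ _ => 1) (fun _ => smoothFun_const 1)
    (fun _ => ε₂) univ_mem (fun s _ => by simp)]
  simp [poisson_const]

theorem eq_sum_dual (σ : ∀ r : Conn L, A r.1) (x : V) (s : Conn L)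
    (hs : s.1 ∈ (sectionFrameAt n F A x).nhd) :
    σ s = ∑ i, (sectionFrameAt n F A x).dual i s.1 (σ s) • (sectionFrameAt n F A x).sec i s.1 :=
  ((sectionFrameAt n F A x).sum_dual s.1 hs (σ s)).symm

/-- The Hamiltonian algebroid on the pull-back bundle that is defined by a lift. -/
def hamiltonianAlgebroid : HamiltonianAlgebroid n F A L where
  ham := H.ham
  ham_smooth σ hσ := smoothFun_of_eventually_eq fun r => by
    set fr := sectionFrameAt n F A r.1
    refine ⟨fr.nhd, fr.isOpen.mem_nhds fr.mem,
      fun s => ∑ i, fr.dual i s.1 (σ s) * H.ham s (fr.sec i s.1),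
      .sum fun i _ => (hσ.smoothFun_dual fr i).mul (H.ham_smooth _), fun s hs => ?_⟩
    conv_lhs => rw [eq_sum_dual (n := n) (F := F) σ r.1 s hs, map_sum]
    exact Finset.sum_congr rfl fun i _ => map_smul _ _ _
  bracket := H.pullbackBracket
  bracket_smooth ε σ hσ := smoothSec_of_eventually_eq fun r => by
    set fr := sectionFrameAt n F A r.1
    refine ⟨fr.nhd, fr.isOpen.mem_nhds fr.mem, fun s =>
      ∑ i : Fin (Module.finrank ℝ F) ⊕ Fin (Module.finrank ℝ F),
        (Sum.elim (fun i s => fr.dual i s.1 (σ s))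
          (fun i s => poisson (fun t : Conn L => H.ham t (ε t.1))
            (fun t => fr.dual i t.1 (σ t)) s) i : Conn L → ℝ) s
        • (Sum.elim (fun i => 𝒜.bracket ε (fr.sec i)) fr.sec i : Sec n F A) s.1,
      smoothSec_sum_smul _ ?_ fun i _ => smoothSec_comp_proj _, fun s hs => ?_⟩
    · rintro (i | i) -
      · exact hσ.smoothFun_dual fr i
      · exact (H.ham_smooth ε).poisson (hσ.smoothFun_dual fr i)
    · rw [H.pullbackBracket_eq ε (fun i => hσ.smoothFun_dual fr i) fr.sec
        (fr.isOpen.mem_nhds hs) fun t ht => eq_sum_dual (n := n) (F := F) σ r.1 t ht]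
      beta_reduce
      rw [Finset.sum_add_distrib, Fintype.sum_sum_type]
      rfl
  bracket_add_left ε₁ ε₂ σ _ := by
    funext r
    have h : (fun s : Conn L => H.ham s ((ε₁ + ε₂) s.1))
        = fun s => H.ham s (ε₁ s.1) + H.ham s (ε₂ s.1) := funext fun s => map_add _ _ _
    change H.pullbackBracket _ σ r = H.pullbackBracket ε₁ σ r + H.pullbackBracket ε₂ σ r
    unfold pullbackBracket
    rw [h, ← Finset.sum_add_distrib]
    refine Finset.sum_congr rfl fun i _ => ?_
    rw [poisson_add_left (H.ham_smooth ε₁) (H.ham_smooth ε₂), map_add, LinearMap.add_apply,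
      ContMDiffSection.coe_add, Pi.add_apply]
    module
  bracket_smul_left t ε σ _ := by
    funext r
    have h : (fun s : Conn L => H.ham s ((t • ε) s.1)) = fun s => t * H.ham s (ε s.1) :=
      funext fun s => map_smul _ _ _
    change H.pullbackBracket _ σ r = t • H.pullbackBracket ε σ r
    unfold pullbackBracket
    rw [h, Finset.smul_sum]
    refine Finset.sum_congr rfl fun i _ => ?_
    rw [poisson_smul_left t (H.ham_smooth ε), map_smul, LinearMap.smul_apply,
      ContMDiffSection.coe_smul, Pi.smul_apply]
    module
  bracket_add_right ε σ₁ σ₂ h₁ h₂ := by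
    funext r
    change H.pullbackBracket ε _ r = H.pullbackBracket ε σ₁ r + H.pullbackBracket ε σ₂ r
    unfold pullbackBracket
    rw [← Finset.sum_add_distrib]
    refine Finset.sum_congr rfl fun i _ => ?_
    simp only [Pi.add_apply, map_add]
    rw [poisson_add (h₁.smoothFun_dual _ i) (h₂.smoothFun_dual _ i)]
    module
  antisymm ε₁ ε₂ := by
    funext r
    change H.pullbackBracket ε₁ _ r = - H.pullbackBracket ε₂ _ r
    rw [pullbackBracket_comp_proj, pullbackBracket_comp_proj, 𝒜.bracket_skew]
    rfl
  ham_bracket ε σ hσ r := by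
    set fr := sectionFrameAt n F A r.1 with hfr
    have h1 : ∀ s : Conn L, s.1 ∈ fr.nhd →
        H.ham s (σ s) = ∑ i, fr.dual i s.1 (σ s) * H.ham s (fr.sec i s.1) := by
      intro s hs
      conv_lhs => rw [eq_sum_dual (n := n) (F := F) σ r.1 s hs, map_sum]
      exact Finset.sum_congr rfl fun i _ => map_smul _ _ _
    rw [poisson_congr (fr.isOpen.mem_nhds fr.mem) h1,
      poisson_sum _ fun i _ => (hσ.smoothFun_dual fr i).mul (H.ham_smooth (fr.sec i))]
    unfold pullbackBracket
    rw [map_sum, ← hfr]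
    refine Finset.sum_congr rfl fun i _ => ?_
    rw [poisson_mul (hσ.smoothFun_dual fr i) (H.ham_smooth (fr.sec i)), H.ham_bracket, map_add,
      map_smul, map_smul]
    rfl
  leibniz ε σ f hσ hf r := by
    set fr := sectionFrameAt n F A r.1 with hfr
    have h1 : ∀ i, (fun s : Conn L => fr.dual i s.1 (f s • σ s))
        = fun s => f s * fr.dual i s.1 (σ s) := fun i => funext fun s => map_smul _ _ _
    have h2 := eq_sum_dual (n := n) (F := F) σ r.1 r fr.mem
    conv_rhs => rw [h2]
    unfold pullbackBracket
    rw [← hfr, Finset.smul_sum, Finset.smul_sum, ← Finset.sum_add_distrib]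
    refine Finset.sum_congr rfl fun i _ => ?_
    rw [h1 i, poisson_mul hf (hσ.smoothFun_dual fr i), map_smul, smul_eq_mul]
    module

end HamiltonianBracket

end HamLift

end

/-! ### Classification of lifts -/

section

section PartitionOfUnity

variable {n : ℕ} {V : Type u} [TopologicalSpace V] [ChartedSpace (Eucl n) V]
  [IsManifold (𝓡 n) ∞ V] [T2Space V] [SecondCountableTopology V] {ι : Type*}

/-- The sheaf of smooth functions is acyclic: a smooth Čech 1-cocycle is a coboundary. -/
theorem exists_sub_eq_of_cocycle (U : ι → TopologicalSpace.Opens V) (hU : ∀ x, ∃ i, x ∈ U i)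
    (g : ι → ι → V → ℝ) (hg : ∀ i j, SmoothOn n (g i j) (U i ∩ U j))
    (hc : ∀ i j k, ∀ x ∈ U i, x ∈ U j → x ∈ U k → g i k x = g i j x + g j k x) :
    ∃ f : ι → V → ℝ, (∀ i, SmoothOn n (f i) (U i)) ∧
      ∀ i j, ∀ x ∈ U i, x ∈ U j → g i j x = f i x - f j x := by
  have : LocallyCompactSpace V := ChartedSpace.locallyCompactSpace (Eucl n) V
  obtain ⟨ρ, hρ⟩ := SmoothPartitionOfUnity.exists_isSubordinate (𝓡 n) isClosed_univ
    (fun i => (U i : Set V)) (fun i => (U i).isOpen)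
    fun x _ => mem_iUnion.2 (hU x)
  refine ⟨fun i x => ∑ᶠ k, ρ k x • g i k x, fun i x hx => ?_, fun i j x hi hj => ?_⟩
  · refine (ρ.contMDiffAt_finsum fun k hk => ?_).contMDiffWithinAt
    exact (hg i k).contMDiffAt (((U i).isOpen.inter (U k).isOpen).mem_nhds ⟨hx, hρ k hk⟩)
  · have hfin : ∀ f : ι → ℝ, (Function.support fun k => ρ k x • f k).Finite := fun f =>
      (ρ.locallyFinite.point_finite x).subset fun k hk h => hk (by
        change ρ k x • f k = 0
        rw [h, zero_smul])
    have h : ∀ k, ρ k x • g i k x = ρ k x • g i j x + ρ k x • g j k x := by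
      intro k
      by_cases hk : ρ k x = 0
      · simp [hk]
      · rw [← smul_add, hc i j k x hi hj (hρ k (subset_closure hk))]
    change g i j x = ∑ᶠ k, ρ k x • g i k x - ∑ᶠ k, ρ k x • g j k x
    rw [finsum_congr h, finsum_add_distrib (hfin _) (hfin _), ← finsum_smul,
      ρ.sum_eq_one (mem_univ x), one_smul, add_sub_cancel_right]

end PartitionOfUnity

section TrivialBundle

variable (n : ℕ) (V : Type u) [TopologicalSpace V] [ChartedSpace (Eucl n) V]

/-- The trivial line bundle. -/
def trivialLineBundle : LineBundle n V where
  fiber := Bundle.Trivial V ℝ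

/-- The constant section `1` of the trivial line bundle. -/
def unitFrame : Frame (trivialLineBundle n V) where
  dom := ⊤
  sec _ := (1 : ℝ)
  smooth := fun x _ => (contMDiffAt_section (F := ℝ) (E := Bundle.Trivial V ℝ) x).2
    contMDiffAt_const |>.contMDiffWithinAt
  ne_zero _ _ := one_ne_zero (α := ℝ)

/-- The trivial line bundle with its global frame. -/
def trivialExpLineBundle : ExpLineBundle n V where
  toLineBundle := trivialLineBundle n V
  exists_frames := ⟨{unitFrame n V}, fun _ => ⟨_, rfl, trivial⟩, by
    rintro _ rfl _ rfl x _ _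
    exact ⟨0, by rw [Real.exp_zero, one_smul]⟩⟩

end TrivialBundle

variable {n : ℕ} {V : Type u} [TopologicalSpace V] [ChartedSpace (Eucl n) V]

theorem ConnAt.form_congr {L : LineBundle n V} {x : V} {e e' : Frame L} (D : ConnAt L x)
    (h : x ∈ e.dom) (h' : x ∈ e'.dom) (he : ∀ᶠ y in 𝓝 x, e'.sec y = e.sec y) :
    D.form e' h' = D.form e h := by
  rw [D.form_eq_add_of_exp h h' (f := fun _ => 0) mdifferentiableAt_const
    (he.mono fun y hy => by rw [hy, Real.exp_zero, one_smul])]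
  have : diff n (fun _ : V => (0 : ℝ)) x = 0 := mfderiv_const
  rw [this, add_zero]

variable [IsManifold (𝓡 n) ∞ V]
  {F : Type v} [NormedAddCommGroup F] [NormedSpace ℝ F]
  {A : V → Type w} [∀ x, AddCommGroup (A x)] [∀ x, Module ℝ (A x)]
  [∀ x, TopologicalSpace (A x)] [TopologicalSpace (TotalSpace F A)] [FiberBundle F A]
  [VectorBundle ℝ F A] {𝒜 : LieAlgebroid n F A} {ι : Type*} {U : ι → TopologicalSpace.Opens V}

theorem nonempty_hamLift [T2Space V] [SecondCountableTopology V] (L : ExpLineBundle n V) :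
    Nonempty (HamLift 𝒜 L.toLineBundle) := by
  obtain ⟨e, he⟩ := L.exists_global_frame
  have hx : ∀ x, x ∈ e.dom := fun x => he ▸ trivial
  refine ⟨HamLift.ofLocal L.toLineBundle
    (fun r => (r.2.form e (hx r.1)).toLinearMap ∘ₗ 𝒜.anchor r.1)
    fun x => ⟨e, fun _ => 0, hx x, fun ε => contMDiffOn_const, fun ε₁ ε₂ x _ => ?_,
      fun x hx D a => (add_zero _).symm⟩⟩
  change (0 : ℝ) = 𝒜.der ε₁ (fun _ => 0) x - 𝒜.der ε₂ (fun _ => 0) x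
  simp [𝒜.der_const]

namespace Lift

variable {ℓ ℓ' : Lift 𝒜} {c c' : Cochain1 A ι} {e : ι → Frame ℓ.toLineBundle}
  {e' : ι → Frame ℓ'.toLineBundle} {he : ∀ i, (e i).dom = U i} {he' : ∀ i, (e' i).dom = U i}

/-- The cocycles of equivalent lifts differ by the coboundary of the logarithms of the functions
`Φ⁻¹(e'_α) / e_α`. -/
theorem Equivalent.isCoboundary1 (h : ℓ.Equivalent ℓ') (hc : ℓ.IsGivenBy c e he)
    (hc' : ℓ'.IsGivenBy c' e' he') : IsCoboundary1 𝒜 U (c - c') := by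
  obtain ⟨Φ, hΦ⟩ := h
  have hd : ∀ i x, x ∈ U i → x ∈ (e i).dom := fun i x hx => by rwa [he i]
  have hd' : ∀ i x, x ∈ U i → x ∈ (Φ.pullFrame (e' i)).dom := fun i x hx => by
    change x ∈ (e' i).dom
    rwa [he' i]
  refine ⟨fun i => (e i).logQuot (Φ.pullFrame (e' i)),
    fun i => Frame.contMDiffOn_logQuot.mono fun x hx => ⟨hd i x hx, hd' i x hx⟩,
    fun i ε x hx => ?_, fun i j x hi hj => ?_⟩
  · let D : ConnAt ℓ.toLineBundle x := ConnAt.ofForm (e i) (hd i x hx) 0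
    have h1 := hc.ham_eq i x (hd i x hx) D (ε x)
    have h2 := hc'.ham_eq i x (hd' i x hx) (Φ.mapConn D) (ε x)
    rw [hΦ x D (ε x), h1] at h2
    have h3 : (Φ.mapConn D).form (e' i) (hd' i x hx) (𝒜.anchor x (ε x))
        = D.form (e i) (hd i x hx) (𝒜.anchor x (ε x))
          + 𝒜.der ε ((e i).logQuot (Φ.pullFrame (e' i))) x :=
      congrArg (fun l : Cotangent n x => l (𝒜.anchor x (ε x)))
        (D.form_eq_add_logQuot (hd i x hx) (hd' i x hx))
    rw [h3] at h2
    change c.form i x (ε x) - c'.form i x (ε x) = _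
    linarith
  · have q : ∀ i, x ∈ U i → (e i).quot (Φ.pullFrame (e' i)) x ≠ 0 := fun i hx =>
      Frame.quot_ne_zero (hd i x hx) (hd' i x hx)
    have s : ∀ i, x ∈ U i → (e i).quot (Φ.pullFrame (e' i)) x • (e i).sec x
        = (Φ.pullFrame (e' i)).sec x := fun i hx => Frame.quot_smul (hd i x hx)
    have t : (Φ.pullFrame (e' i)).sec x
        = Real.exp (c'.fn i j x) • (Φ.pullFrame (e' j)).sec x := by
      change (Φ.toEquiv x).symm ((e' i).sec x) = _ • (Φ.toEquiv x).symm ((e' j).sec x)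
      rw [hc'.transition i j x hi hj, map_smul]
    rw [← s i hi, ← s j hj, hc.transition i j x hi hj, smul_smul, smul_smul] at t
    have t' := congrArg Real.log (smul_left_injective ℝ ((e j).ne_zero x (hd j x hj)) t)
    rw [Real.log_mul (q i hi) (Real.exp_ne_zero _), Real.log_mul (Real.exp_ne_zero _) (q j hj),
      Real.log_exp, Real.log_exp] at t'
    change c.fn i j x - c'.fn i j x = Real.log _ - Real.log _
    linarith

variable [T2Space V] [FiniteDimensional ℝ F] [ContMDiffVectorBundle ∞ F A (𝓡 n)]

/-- Every lift is given by a cocycle: restrict a global frame of its line bundle. -/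
theorem exists_isGivenBy [SecondCountableTopology V] (ℓ : Lift 𝒜)
    (U : ι → TopologicalSpace.Opens V) :
    ∃ c ∈ Z1 𝒜 U, ∃ (e : ι → Frame ℓ.toLineBundle) (he : ∀ i, (e i).dom = U i),
      ℓ.IsGivenBy c e he := by
  obtain ⟨e₀, he₀⟩ := ℓ.toExpLineBundle.exists_global_frame
  let e : ι → Frame ℓ.toLineBundle := fun i =>
    e₀.rescale (fun _ => 0) (U i) (by rw [he₀]; exact le_top) contMDiffOn_const
  have hpot : ∀ i j x a, x ∈ U i → x ∈ U j →
      ℓ.lift.potential (e i) x a = ℓ.lift.potential (e j) x a := by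
    intro i j x a hi hj
    have h1 := ℓ.lift.ham_eq (e i) x hi (ConnAt.ofForm (e i) hi 0) a
    have h2 := ℓ.lift.ham_eq (e j) x hj (ConnAt.ofForm (e i) hi 0) a
    rw [ConnAt.form_congr (e := e i) (e' := e j) _ hi hj (Eventually.of_forall fun _ => rfl)] at h2
    exact add_left_cancel (h1.symm.trans h2)
  refine ⟨(fun i => ℓ.lift.potential (e i), fun _ _ _ => 0), ?_, e, fun _ => rfl, ?_, ?_⟩
  · refine ⟨fun i ε => ℓ.lift.smoothOn_potential (e i) ε, fun _ _ => contMDiffOn_const,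
      fun i ε₁ ε₂ x hx => ℓ.lift.potential_closed (e i) ε₁ ε₂ x hx, fun i j ε x hi hj => ?_,
      fun _ _ _ _ _ _ _ => (add_zero (0 : ℝ)).symm⟩
    change 𝒜.der ε (fun _ => 0) x
      = - ℓ.lift.potential (e i) x (ε x) + ℓ.lift.potential (e j) x (ε x)
    rw [𝒜.der_const, hpot i j x _ hi hj, neg_add_cancel]
  · intro i j x _ _
    change (e i).sec x = Real.exp 0 • (e i).sec x
    rw [Real.exp_zero, one_smul]
  · exact fun i x hx D a => ℓ.lift.ham_eq (e i) x hx D a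

/-- Every cocycle gives a lift: the functions `c_αβ = f_α - f_β` are the transition functions of the
frames `exp(f_α)` of the trivial line bundle. -/
theorem exists_of_cocycle [SecondCountableTopology V] (hU : ∀ x, ∃ i, x ∈ U i)
    {c : Cochain1 A ι} (hc : c ∈ Z1 𝒜 U) :
    ∃ (ℓ : Lift 𝒜) (e : ι → Frame ℓ.toLineBundle) (he : ∀ i, (e i).dom = U i),
      ℓ.IsGivenBy c e he := by
  obtain ⟨f, hf, hfc⟩ := exists_sub_eq_of_cocycle U hU c.fn hc.smooth_fun hc.cech
  let e : ι → Frame (trivialLineBundle n V) := fun i =>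
    (unitFrame n V).rescale (f i) (U i) le_top (hf i)
  have htr : ∀ i j, ∀ x ∈ U i, x ∈ U j →
      (e i).sec x = Real.exp (c.fn i j x) • (e j).sec x := by
    intro i j x hi hj
    change Real.exp (f i x) • _ = Real.exp (c.fn i j x) • Real.exp (f j x) • _
    rw [smul_smul, ← Real.exp_add, hfc i j x hi hj, sub_add_cancel]
  have hcons : ∀ i j x (hi : x ∈ U i) (hj : x ∈ U j) (D : ConnAt (trivialLineBundle n V) x)
      (a : A x), D.form (e i) hi (𝒜.anchor x a) + c.form i x a
        = D.form (e j) hj (𝒜.anchor x a) + c.form j x a := by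
    intro i j x hi hj D a
    obtain ⟨ε, rfl⟩ := exists_sec_apply_eq (n := n) (F := F) a
    have hij := (U i).isOpen.inter (U j).isOpen
    have h1 := D.form_eq_add_of_exp (e := e j) (e' := e i) hj hi (f := c.fn i j)
      ((hc.smooth_fun i j).mdifferentiableAt hij ⟨hi, hj⟩)
      (by filter_upwards [hij.mem_nhds ⟨hi, hj⟩] with y hy using htr i j y hy.1 hy.2)
    have h2 := hc.compat i j ε x hi hj
    have h3 : D.form (e i) hi (𝒜.anchor x (ε x))
        = D.form (e j) hj (𝒜.anchor x (ε x)) + 𝒜.der ε (c.fn i j) x :=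
      congrArg (fun l : Cotangent n x => l (𝒜.anchor x (ε x))) h1
    rw [h3, h2]
    ring
  choose k hk using hU
  let ham : ∀ r : Conn (trivialLineBundle n V), A r.1 →ₗ[ℝ] ℝ := fun r =>
    (r.2.form (e (k r.1)) (hk r.1)).toLinearMap ∘ₗ 𝒜.anchor r.1 + c.form (k r.1) r.1
  have hham : ∀ i x (hx : x ∈ (e i).dom) (D : ConnAt (trivialLineBundle n V) x) (a : A x),
      ham ⟨x, D⟩ a = D.form (e i) hx (𝒜.anchor x a) + c.form i x a :=
    fun i x hx D a => hcons _ _ x (hk x) hx D a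
  exact ⟨⟨trivialExpLineBundle n V, HamLift.ofLocal _ ham fun x => ⟨e (k x), c.form (k x), hk x,
    hc.smooth_form _, hc.closed _, hham (k x)⟩⟩, e, fun _ => rfl, htr, hham⟩

/-- If the cocycles differ by the coboundary of `f_α`, the isomorphism that takes `e_α` to
`exp(-f_α) e'_α` is an equivalence of the lifts. -/
theorem IsGivenBy.equivalent (hU : ∀ x, ∃ i, x ∈ U i) (hc : ℓ.IsGivenBy c e he)
    (hc' : ℓ'.IsGivenBy c' e' he') (h : IsCoboundary1 𝒜 U (c - c')) : ℓ.Equivalent ℓ' := by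
  obtain ⟨f, hf, hform, hfn⟩ := h
  have hd : ∀ i x, x ∈ U i → x ∈ (e i).dom := fun i x hx => by rwa [he i]
  have hd' : ∀ i x, x ∈ U i → x ∈ (e' i).dom := fun i x hx => by rwa [he' i]
  let e'' : ι → Frame ℓ'.toLineBundle := fun i =>
    (e' i).rescale (fun y => - f i y) (U i) (he' i).ge (hf i).neg
  have hexp : ∀ i y, (e' i).sec y = Real.exp (f i y) • (e'' i).sec y := fun i y => by
    change _ = Real.exp (f i y) • Real.exp (- f i y) • (e' i).sec y
    rw [smul_smul, ← Real.exp_add, add_neg_cancel, Real.exp_zero, one_smul]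
  obtain ⟨Φ, hΦ⟩ := LineIso.exists_of_frames e e'' he
    (fun x => (hU x).imp fun i hx => hd i x hx) fun i j x hi hj => by
      rw [he i] at hi
      rw [he j] at hj
      have h1 : (e i).quot (e j) x = Real.exp (c.fn j i x) :=
        Frame.coord_eq (hd i x hi) (hc.transition j i x hj hi)
      have h2 : (e'' i).quot (e'' j) x = Real.exp (c.fn j i x) := by
        refine Frame.coord_eq (e := e'' i) hi ?_
        change Real.exp (- f j x) • (e' j).sec x = _
        rw [hc'.transition j i x hj hi, hexp i x, smul_smul, smul_smul, ← Real.exp_add,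
          ← Real.exp_add]
        have h3 : c.fn j i x - c'.fn j i x = f i x - f j x := hfn j i x hj hi
        congr 2
        linarith
      rw [h1, h2]
  refine ⟨Φ, fun x D a => ?_⟩
  obtain ⟨i, hx⟩ := hU x
  obtain ⟨ε, rfl⟩ := exists_sec_apply_eq (n := n) (F := F) a
  rw [hc.ham_eq i x (hd i x hx), hc'.ham_eq i x (hd' i x hx)]
  have h1 : (Φ.mapConn D).form (e'' i) hx = D.form (e i) (hd i x hx) := by
    refine D.form_congr (e := e i) (e' := Φ.pullFrame (e'' i)) (hd i x hx) hx ?_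
    filter_upwards [(U i).isOpen.mem_nhds hx] with y hy
    change (Φ.toEquiv y).symm ((e'' i).sec y) = (e i).sec y
    rw [LinearEquiv.symm_apply_eq, hΦ i y (hd i y hy)]
  have h2 := (Φ.mapConn D).form_eq_add_of_exp (e := e'' i) (e' := e' i) hx (hd' i x hx)
    ((hf i).mdifferentiableAt (U i).isOpen hx) (Eventually.of_forall fun y => hexp i y)
  have h3 : (Φ.mapConn D).form (e' i) (hd' i x hx) (𝒜.anchor x (ε x))
      = D.form (e i) (hd i x hx) (𝒜.anchor x (ε x)) + 𝒜.der ε (f i) x := by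
    rw [h1] at h2
    exact congrArg (fun l : Cotangent n x => l (𝒜.anchor x (ε x))) h2
  have h4 : c.form i x (ε x) - c'.form i x (ε x) = 𝒜.der ε (f i) x := hform i ε x hx
  rw [h3]
  linarith

/-- The classification of lifts by the first cohomology. -/
theorem exists_equiv_H1 [SecondCountableTopology V] (𝒜 : LieAlgebroid n F A)
    (U : ι → TopologicalSpace.Opens V) (hU : ∀ x, ∃ i, x ∈ U i) :
    ∃ Θ : LiftClass 𝒜 ≃ H1 𝒜 U, ∀ (ℓ : Lift 𝒜) (c : Z1 𝒜 U)
      (e : ι → Frame ℓ.toLineBundle) (he : ∀ i, (e i).dom = U i),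
      ℓ.IsGivenBy c.1 e he → Θ (Quotient.mk _ ℓ) = Submodule.Quotient.mk c := by
  choose C hC E hE hCE using fun ℓ : Lift 𝒜 => ℓ.exists_isGivenBy U
  let Z : Lift 𝒜 → H1 𝒜 U := fun ℓ => Submodule.Quotient.mk ⟨C ℓ, hC ℓ⟩
  have hZ : ∀ ℓ ℓ', ℓ.Equivalent ℓ' → Z ℓ = Z ℓ' := fun ℓ ℓ' h =>
    (Submodule.Quotient.eq _).2 (h.isCoboundary1 (hCE ℓ) (hCE ℓ'))
  have hval : ∀ (ℓ : Lift 𝒜) (c : Z1 𝒜 U) (e : ι → Frame ℓ.toLineBundle)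
      (he : ∀ i, (e i).dom = U i), ℓ.IsGivenBy c.1 e he → Z ℓ = Submodule.Quotient.mk c :=
    fun ℓ c e he h =>
      (Submodule.Quotient.eq _).2 (Equivalent.isCoboundary1 (Setoid.refl ℓ) (hCE ℓ) h)
  have hbij : Function.Bijective (Quotient.lift Z hZ : LiftClass 𝒜 → H1 𝒜 U) := by
    constructor
    · rintro ⟨ℓ⟩ ⟨ℓ'⟩ h
      exact Quotient.sound ((hCE ℓ).equivalent hU (hCE ℓ') ((Submodule.Quotient.eq _).1 h))
    · intro y
      obtain ⟨c, rfl⟩ := Submodule.Quotient.mk_surjective _ y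
      obtain ⟨ℓ, e, he, h⟩ := exists_of_cocycle hU c.2
      exact ⟨Quotient.mk _ ℓ, hval ℓ c e he h⟩
  exact ⟨Equiv.ofBijective _ hbij, hval⟩

end Lift

end

end

theorem lemma2p1 {n : ℕ} {V : Type u} [TopologicalSpace V] [ChartedSpace (Eucl n) V]
    [IsManifold (𝓡 n) ∞ V] [T2Space V] [SecondCountableTopology V]
    {F : Type v} [NormedAddCommGroup F] [NormedSpace ℝ F] [FiniteDimensional ℝ F]
    {A : V → Type w} [∀ x, AddCommGroup (A x)] [∀ x, Module ℝ (A x)]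
    [∀ x, TopologicalSpace (A x)] [TopologicalSpace (TotalSpace F A)] [FiberBundle F A]
    [VectorBundle ℝ F A] [ContMDiffVectorBundle ∞ F A (𝓡 n)] (𝒜 : LieAlgebroid n F A) :
    (∀ (L : ExpLineBundle n V) (x : V) (D D' : ConnAt L.toLineBundle x),
      ∃! ξ : Cotangent n x, ξ +ᵥ D = D') ∧
    (∀ L : ExpLineBundle n V, Nonempty (HamLift 𝒜 L.toLineBundle)) ∧
    (∀ ℓ : Lift 𝒜, ∃ H : HamiltonianAlgebroid n F A ℓ.toLineBundle, H.ham = ℓ.lift.ham ∧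
      ∀ ε₁ ε₂ : Sec n F A, ∀ r : Conn ℓ.toLineBundle,
        H.bracket ε₁ (fun s => ε₂ s.1) r = 𝒜.bracket ε₁ ε₂ r.1) ∧
    (∀ (ℓ : Lift 𝒜) (e : Frame ℓ.toLineBundle), ∃ c : ∀ x, A x →ₗ[ℝ] ℝ,
      (∀ ε : Sec n F A, SmoothOn n (fun x => c x (ε x)) e.dom) ∧
      ∀ (x : V) (hx : x ∈ e.dom) (D : ConnAt ℓ.toLineBundle x) (a : A x),
        ℓ.lift.ham ⟨x, D⟩ a = D.form e hx (𝒜.anchor x a) + c x a) ∧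
    ∀ {ι : Type*} (U : ι → TopologicalSpace.Opens V), (∀ x, ∃ i, x ∈ U i) →
      (∀ ℓ : Lift 𝒜, ∃ c ∈ Z1 𝒜 U, ∃ (e : ι → Frame ℓ.toLineBundle) (he : ∀ i, (e i).dom = U i),
        ℓ.IsGivenBy c e he) ∧
      (∀ c ∈ Z1 𝒜 U, ∃ (ℓ : Lift 𝒜) (e : ι → Frame ℓ.toLineBundle)
        (he : ∀ i, (e i).dom = U i), ℓ.IsGivenBy c e he) ∧
      ∃ Θ : LiftClass 𝒜 ≃ H1 𝒜 U, ∀ (ℓ : Lift 𝒜) (c : Z1 𝒜 U)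
        (e : ι → Frame ℓ.toLineBundle) (he : ∀ i, (e i).dom = U i),
        ℓ.IsGivenBy c.1 e he → Θ (Quotient.mk _ ℓ) = Submodule.Quotient.mk c := by
  refine ⟨fun L x D D' => ConnAt.existsUnique_vadd D D', fun L => nonempty_hamLift L,
    fun ℓ => ⟨ℓ.lift.hamiltonianAlgebroid, rfl,
      fun ε₁ ε₂ r => ℓ.lift.pullbackBracket_comp_proj ε₁ ε₂ r⟩,
    fun ℓ e => ⟨ℓ.lift.potential e, ℓ.lift.smoothOn_potential e,
      fun x hx D a => ℓ.lift.ham_eq e x hx D a⟩,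
    fun U hU => ⟨fun ℓ => ℓ.exists_isGivenBy U, fun c hc => Lift.exists_of_cocycle hU hc,
      Lift.exists_equiv_H1 𝒜 U hU⟩⟩
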